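/- **Setting.** Let $d\ge 2$, $n\ge 1$, $r\ge 0$ be integers and let $\triangle$ be a finite face-to-face simplicial partition, into $d$-simplices, of a closed polyhedral set $\Omega\subset\mathbb{R}^d$. Let $|\triangle|$ be the largest diameter of its simplices and $\rho_T$ the inradius of a simplex $T$; $\triangle$ is $\beta$-quasi-uniform if $|\triangle|/\rho_T\le\beta$ for all $T\in\triangle$. Let $S^r_n(\triangle)$ be the space of functions that are continuous on $\Omega$, $C^r$ in its interior, and polynomial of degree at most $n$ on each simplex, and let $\mathcal W=S^r_n(\triangle)\cap H^1_0(\Omega)$. For a vertex or simplex $s$, $\mathrm{star}^1(s)$ is the collection (or union) of the simplices sharing a vertex with $s$, and $\mathrm{star}^{k+1}(s)$ that of the simplices sharing a vertex with a simplex of $\mathrm{star}^{k}(s)$. For a boundary vertex $v_i$ let $\ell_i:\partial\Omega\to\mathbb{R}$ be $1$ at $v_i$, $0$ at the other boundary vertices, and linear on each boundary simplex. Let $S_i$ be a minimizer of $\int_\Omega|\nabla u|^2$ over all $u\in S^r_n(\triangle)$ with $u=\ell_i$ on $\partial\Omega$. Put $\Omega_i=\mathrm{star}^1(v_i)$. For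 $T\in\triangle$ with $\mathrm{star}^k(T)\cap\Omega_i=\emptyset$, say that $T$ is *$L$ simplices away from $\partial\Omega\setminus\Omega_i$ in the direction opposite to $v_i$* if $L$ is the smallest integer for which there are simplices $T=T_1,\dots,T_{L+1}$ of $\triangle$ and integers $0\le e_1\le\dots\le e_{L+1}$ such that consecutive simplices intersect, $T_{L+1}$ meets $\partial\Omega\setminus\Omega_i$, and, for every $j$, $T_j\in\mathrm{star}^{k+e_j}(T)$ and $\mathrm{star}^{k+e_j}(T)\cap\Omega_i=\emptyset$. For $\ell\ge 1$ and $\kappa\in\mathbb{R}$, say that $\mathcal W$ has an *$\ell$-local Riesz basis of ratio at most $\kappa$* if it has a basis $\{B_\xi\}$, each $B_\xi$ supported in $\mathrm{star}^\ell(T_\xi)$ for some $T_\xi\in\triangle$, and constants $C_1>0$, $C_2\le\kappa C_1$, with $$C_1\sum_\xi|c_\xi|^2\le\Big\|\nabla\sum_\xi c_\xi B_\xi\Big\|_{L^2(\Omega)}^2\le C_2\sum_\xi|c_\xi|^2\qquad\text{for all coefficients }(c_\xi).$$ **Theorem.** (1) For every $\kappa$ and $\ell\ge1$ there is $\sigma\in(0,1)$,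 and for all $d\ge 2$, $n\ge1$, $\beta$, $A$ there is then a constant $K>0$ (depending only on $\kappa,\ell,d,n,\beta,A$), such that the following holds. Let $\triangle$ be a $\beta$-quasi-uniform partition as above for which $\mathcal W=S^r_n(\triangle)\cap H_0^1(\Omega)$ has an $\ell$-local Riesz basis of ratio at most $\kappa$, and let $v_i$ be a boundary vertex. If $r\ge 1$, assume also that there is $G_i\in S^r_n(\triangle)$ with $G_i=\ell_i$ on $\partial\Omega$, supported in $\mathrm{star}^\ell(v_i)$, with $\|\nabla G_i\|_{L^2(\Omega)}^2\le A|\triangle|^{d-2}$. Let $v\in\Omega\setminus\Omega_i$, let $T\in\triangle$ contain $v$, let $k\ge1$ satisfy $\mathrm{star}^k(T)\cap\Omega_i=\emptyset$, and let $L\ge1$ be such that $T$ is $L$ simplices away from $\partial\Omega\setminus\Omega_i$ in the direction opposite to $v_i$. Then $$|S_i(v)|\le K\,(L+1)\,\sigma^k .$$ In particular $K$ and $\sigma$ do not depend on $L,k,v,T,v_i$, and depend on $\triangle$ and $\Omega$ only through the stated parameters. (2) For continuous splines ($r=0$) the basis in (1) always exists: for all $d\ge2$, $n\ge1$ and every partition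 $\triangle$ there is a $\kappa$ such that $S^0_n(\triangle)\cap H^1_0(\Omega)$ has a $1$-local Riesz basis of ratio at most $\kappa$. -/

import Mathlib

open Set MeasureTheory

noncomputable section

namespace GBC

/-- A simplicial partition of a polyhedral set in `ℝ^d`: a finite (face-to-face) geometric
simplicial complex in which every face is a face of a `d`-dimensional simplex. A simplex is
recorded by the finite set of its vertices. -/
structure SimplicialPartition (d : ℕ) where
  complex : Geometry.SimplicialComplex ℝ (EuclideanSpace ℝ (Fin d))
  finite : complex.faces.Finite
  pure : ∀ s ∈ complex.faces, ∃ T ∈ complex.faces, s ⊆ T ∧ T.card = d + 1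

namespace SimplicialPartition

variable {d : ℕ} (P : SimplicialPartition d)

/-- The `d`-dimensional simplices of the partition (given by their `d + 1` vertices). -/
def simplices : Set (Finset (EuclideanSpace ℝ (Fin d))) :=
  {T | T ∈ P.complex.faces ∧ T.card = d + 1}

/-- The closed polyhedral set `Ω` that is partitioned. -/
def domain : Set (EuclideanSpace ℝ (Fin d)) := P.complex.space

/-- The size `|△|`: the largest diameter of the simplices. -/
def meshSize : ℝ :=
  sSup ((fun T : Finset (EuclideanSpace ℝ (Fin d)) =>
    Metric.diam (convexHull ℝ (T : Set (EuclideanSpace ℝ (Fin d))))) '' P.simplices)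

/-- The radius `ρ_T` of the inscribed ball of the simplex with vertex set `T`. -/
def inradius (T : Finset (EuclideanSpace ℝ (Fin d))) : ℝ :=
  sSup {ρ : ℝ | ∃ x, Metric.closedBall x ρ ⊆ convexHull ℝ (T : Set (EuclideanSpace ℝ (Fin d)))}

/-- `β`-quasi-uniformity: `|△| / ρ_T ≤ β` for every simplex `T`. -/
def QuasiUniform (β : ℝ) : Prop :=
  ∀ T ∈ P.simplices, P.meshSize ≤ β * inradius T

/-- `star^k(s)` as a collection of simplices, for a finite set `s` of vertices: `star^1(s)` consists
of the simplices with a vertex in `s`, and `star^{k+1}(s)` of the simplices that share a vertex with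
a simplex of `star^k(s)`. For a vertex `p` it is used with `s = {p}`, for a simplex `T` with the
vertex set of `T`. The value at `k = 0` is never used. -/
def star (s : Finset (EuclideanSpace ℝ (Fin d))) : ℕ → Set (Finset (EuclideanSpace ℝ (Fin d)))
  | 0 => ∅
  | 1 => {T | T ∈ P.simplices ∧ ∃ q ∈ T, q ∈ s}
  | k + 2 => {T | T ∈ P.simplices ∧ ∃ T' ∈ star s (k + 1), ∃ q ∈ T, q ∈ T'}

/-- `star^k(s)` as a point set: the union of its (closed) simplices. -/
def starSet (s : Finset (EuclideanSpace ℝ (Fin d))) (k : ℕ) : Set (EuclideanSpace ℝ (Fin d)) :=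
  ⋃ T ∈ P.star s k, convexHull ℝ (T : Set (EuclideanSpace ℝ (Fin d)))

/-- The spline space `S^r_n(△)`: functions that are continuous on `Ω`, of class `C^r` in its
interior, and on each simplex equal to a polynomial of degree at most `n`. -/
def IsSpline (r n : ℕ) (u : EuclideanSpace ℝ (Fin d) → ℝ) : Prop :=
  ContinuousOn u P.domain ∧ ContDiffOn ℝ r u (interior P.domain) ∧
    ∀ T ∈ P.simplices, ∃ p : MvPolynomial (Fin d) ℝ, p.totalDegree ≤ n ∧
      ∀ x ∈ convexHull ℝ (T : Set (EuclideanSpace ℝ (Fin d))),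
        u x = MvPolynomial.eval (fun j => x j) p

/-- The space `W = S^r_n(△) ∩ H^1_0(Ω)`. A spline is continuous on `Ω` and piecewise polynomial, so
it lies in `H^1_0(Ω)` exactly if it vanishes on `∂Ω`. -/
def IsSplineZero (r n : ℕ) (u : EuclideanSpace ℝ (Fin d) → ℝ) : Prop :=
  P.IsSpline r n u ∧ ∀ x ∈ frontier P.domain, u x = 0

/-- The Dirichlet energy `‖∇u‖² = ∫_Ω |∇u|²`. For a spline `u` the classical gradient exists
off the null set of the faces of dimension less than `d`. -/
def energy (u : EuclideanSpace ℝ (Fin d) → ℝ) : ℝ :=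
  ∫ x in P.domain, ‖gradient u x‖ ^ 2

/-- `u = ℓ_p` on `∂Ω`, where `ℓ_p` is `1` at the vertex `p`, `0` at all other boundary vertices, and
linear on each boundary simplex: the value of `ℓ_p` at a boundary point which is a
convex combination of the vertices of a face is the coefficient of `p`. -/
def HasHatBoundaryValues (p : EuclideanSpace ℝ (Fin d)) (u : EuclideanSpace ℝ (Fin d) → ℝ) : Prop :=
  ∀ s ∈ P.complex.faces, ∀ w : EuclideanSpace ℝ (Fin d) → ℝ,
    (∀ q ∈ s, 0 ≤ w q) → ∑ q ∈ s, w q = 1 → ∑ q ∈ s, w q • q ∈ frontier P.domain →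
      (p ∈ s → u (∑ q ∈ s, w q • q) = w p) ∧ (p ∉ s → u (∑ q ∈ s, w q • q) = 0)

/-- `S` is a boundary GBC spline for the vertex `p`: it minimizes `∫_Ω |∇u|²` among all
`u ∈ S^r_n(△)` with `u = ℓ_p` on `∂Ω`. -/
def IsBoundaryGBCSpline (r n : ℕ) (p : EuclideanSpace ℝ (Fin d))
    (S : EuclideanSpace ℝ (Fin d) → ℝ) : Prop :=
  P.IsSpline r n S ∧ P.HasHatBoundaryValues p S ∧
    ∀ u, P.IsSpline r n u → P.HasHatBoundaryValues p u → P.energy S ≤ P.energy u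

/-- `W = S^r_n(△) ∩ H^1_0(Ω)` has an `ℓ`-local basis `B_ξ` (each `B_ξ` is supported in
`star^ℓ(T_ξ)` for some simplex `T_ξ`) that satisfies the Riesz inequalities
`C₁ ∑ |c_ξ|² ≤ ‖∇ ∑ c_ξ B_ξ‖² ≤ C₂ ∑ |c_ξ|²` with constants of ratio `C₂ / C₁ ≤ κ`.
(The lower inequality contains linear independence.) -/
def HasLocalRieszBasis (r n l : ℕ) (κ : ℝ) : Prop :=
  ∃ (m : ℕ) (B : Fin m → EuclideanSpace ℝ (Fin d) → ℝ)
    (τ : Fin m → Finset (EuclideanSpace ℝ (Fin d))) (C₁ C₂ : ℝ),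
    0 < C₁ ∧ C₂ ≤ κ * C₁ ∧
    (∀ ξ, P.IsSplineZero r n (B ξ)) ∧
    (∀ ξ, τ ξ ∈ P.simplices ∧ ∀ x ∈ P.domain, x ∉ P.starSet (τ ξ) l → B ξ x = 0) ∧
    (∀ u, P.IsSplineZero r n u → ∃ c : Fin m → ℝ, ∀ x ∈ P.domain, u x = ∑ ξ, c ξ * B ξ x) ∧
    ∀ c : Fin m → ℝ,
      C₁ * ∑ ξ, c ξ ^ 2 ≤ P.energy (fun x => ∑ ξ, c ξ * B ξ x) ∧
      P.energy (fun x => ∑ ξ, c ξ * B ξ x) ≤ C₂ * ∑ ξ, c ξ ^ 2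

/-- There is a spline `G ∈ S^r_n(△)` with `G = ℓ_p` on `∂Ω` that is supported in `star^ℓ(p)` and has
energy `‖∇G‖² ≤ A |△|^{d-2}` (the power of `|△|` makes the bound invariant under scaling). -/
def HasLocalLift (r n l : ℕ) (A : ℝ) (p : EuclideanSpace ℝ (Fin d)) : Prop :=
  ∃ G, P.IsSpline r n G ∧ P.HasHatBoundaryValues p G ∧
    (∀ x ∈ P.domain, x ∉ P.starSet {p} l → G x = 0) ∧
    P.energy G ≤ A * P.meshSize ^ (d - 2)

/-- There are simplices `T = T_1, …, T_{L+1}` (here `T_{j+1} = C j`), consecutive ones meeting, the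
last one meeting `∂Ω \ Ω_p` with `Ω_p = star(p)`, and numbers `0 ≤ e_1 ≤ … ≤ e_{L+1}` such that
`T_j ∈ star^{k + e_j}(T) ⊆ Ω_p^c` for all `j`. -/
def HasOppositeChain (p : EuclideanSpace ℝ (Fin d)) (k : ℕ)
    (T : Finset (EuclideanSpace ℝ (Fin d))) (L : ℕ) : Prop :=
  ∃ (C : ℕ → Finset (EuclideanSpace ℝ (Fin d))) (e : ℕ → ℕ),
    C 0 = T ∧ (∀ j ≤ L, C j ∈ P.simplices) ∧
    (∀ j < L, (convexHull ℝ (C j : Set (EuclideanSpace ℝ (Fin d))) ∩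
      convexHull ℝ (C (j + 1) : Set (EuclideanSpace ℝ (Fin d)))).Nonempty) ∧
    (convexHull ℝ (C L : Set (EuclideanSpace ℝ (Fin d))) ∩
      (frontier P.domain \ P.starSet {p} 1)).Nonempty ∧
    (∀ j < L, e j ≤ e (j + 1)) ∧
    ∀ j ≤ L, C j ∈ P.star T (k + e j) ∧ Disjoint (P.starSet T (k + e j)) (P.starSet {p} 1)

/-- `T` is `L` simplices away from `∂Ω \ Ω_p` in the direction opposite to `p`: `L` is the
smallest integer for which there is such a chain. -/
def IsSimplicesAwayOpposite (p : EuclideanSpace ℝ (Fin d)) (k : ℕ)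
    (T : Finset (EuclideanSpace ℝ (Fin d))) (L : ℕ) : Prop :=
  IsLeast {L' | P.HasOppositeChain p k T L'} L

end SimplicialPartition

end GBC

end

noncomputable section

namespace GBC

namespace SimplicialPartition

variable {d : ℕ} (P : SimplicialPartition d)

/-! ### Stars -/

/-! The decay is a discrete Caccioppoli (hole-filling) argument carried out on coefficients. Let `G`
be the local lift and expand `S - G = ∑ c_ξ B_ξ` in the Riesz basis. Minimality makes `S` orthogonal
to `W` in the Dirichlet form, so `S - G` is orthogonal to every `B_ξ` whose support is away from
that of `G`. Sort the indices into layers by the distance of `τ ξ` from the boundary vertex, each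
layer as wide as the interaction range `2l + 2` of two basis functions. The outer part `w` of the
expansion then interacts only with the adjacent layer `z`, and orthogonality gives `D w w ≤ D z z`.
By the Riesz inequalities, the squared coefficients beyond a layer sum to at most `κ` times the sum
within it, so each layer contributes a factor `κ / (1 + κ)` (`sum_sq_le_pow_of_local`).

To pass to a point value, keep only the basis functions that are nonzero at `v`. Their sum `u` has
exponentially small energy and is supported in a star of fixed size around `T` (`exists_near_part`).
A scaled inverse inequality bounds the oscillation of `u` on each simplex by its energy
(`exists_osc_bound_spline`), and `u` has a zero in that star. A path of boundedly many simplices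
leads from the zero to `v` (`IsSplineZero.abs_le`). This yields `K * σ ^ k`; the factor `L + 1 ≥ 1`
is inserted at the end. For `r = 0` the hat function serves as the lift.

For the second assertion, homogenizing `u` as `s ^ n * u (m / s)`, with `s` and `m` formed from the
hat functions of a vertex set, keeps the Bernstein terms of that set. Adding vertices one at a time
telescopes `u` into splines supported in vertex stars (`span_localSplines`). The energy is definite
on the resulting finite-dimensional space, and compactness of the unit sphere supplies the Riesz
constants (`exists_coercive`). -/

theorem simplices_finite : P.simplices.Finite := P.finite.subset fun _ h => h.1

variable {P}

theorem nonempty_of_mem_simplices {T : Finset (EuclideanSpace ℝ (Fin d))} (hT : T ∈ P.simplices) :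
    T.Nonempty := P.complex.nonempty_of_mem_faces hT.1

theorem exists_common_vertex {S T : Finset (EuclideanSpace ℝ (Fin d))}
    (hS : S ∈ P.simplices) (hT : T ∈ P.simplices) {x : EuclideanSpace ℝ (Fin d)}
    (hxS : x ∈ convexHull ℝ (S : Set (EuclideanSpace ℝ (Fin d))))
    (hxT : x ∈ convexHull ℝ (T : Set (EuclideanSpace ℝ (Fin d)))) : ∃ q ∈ S, q ∈ T := by
  have h := P.complex.inter_subset_convexHull hS.1 hT.1 ⟨hxS, hxT⟩
  obtain ⟨q, hq⟩ := convexHull_nonempty_iff.1 ⟨x, h⟩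
  exact ⟨q, hq.1, hq.2⟩

theorem star_subset_simplices {s : Finset (EuclideanSpace ℝ (Fin d))} {k : ℕ} :
    P.star s k ⊆ P.simplices := by
  intro T hT
  match k with
  | 0 => exact hT.elim
  | 1 => exact hT.1
  | k + 2 => exact hT.1

theorem mem_star_succ {s T T' : Finset (EuclideanSpace ℝ (Fin d))} {k : ℕ}
    (hT : T ∈ P.simplices) (hT' : T' ∈ P.star s k) {q : EuclideanSpace ℝ (Fin d)}
    (hq : q ∈ T) (hq' : q ∈ T') : T ∈ P.star s (k + 1) := by
  match k with
  | 0 => exact hT'.elim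
  | k + 1 => exact ⟨hT, T', hT', q, hq, hq'⟩

theorem star_mono {s : Finset (EuclideanSpace ℝ (Fin d))} {j k : ℕ} (h : j ≤ k) :
    P.star s j ⊆ P.star s k := by
  induction h with
  | refl => exact subset_rfl
  | step _ ih =>
    intro T hT
    obtain ⟨q, hq⟩ := nonempty_of_mem_simplices (star_subset_simplices hT)
    exact mem_star_succ (star_subset_simplices hT) (ih hT) hq hq

theorem star_trans {s T T' : Finset (EuclideanSpace ℝ (Fin d))} {j k : ℕ}
    (hT : T ∈ P.star s j) (hT' : T' ∈ P.star T k) : T' ∈ P.star s (j + k) := by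
  induction k generalizing T' with
  | zero => exact hT'.elim
  | succ k ih =>
    rcases k with _ | k
    · obtain ⟨h, q, hq, hq'⟩ := hT'
      exact mem_star_succ h hT hq hq'
    · obtain ⟨h, T'', hT'', q, hq, hq'⟩ := hT'
      exact mem_star_succ h (ih hT'') hq hq'

theorem mem_star_one {s T : Finset (EuclideanSpace ℝ (Fin d))} (hT : T ∈ P.simplices)
    {q : EuclideanSpace ℝ (Fin d)} (hq : q ∈ T) (hq' : q ∈ s) : T ∈ P.star s 1 := ⟨hT, q, hq, hq'⟩

theorem star_symm {T T' : Finset (EuclideanSpace ℝ (Fin d))} {k : ℕ} (hT : T ∈ P.simplices)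
    (h : T' ∈ P.star T k) : T ∈ P.star T' k := by
  induction k generalizing T' with
  | zero => exact h.elim
  | succ k ih =>
    rcases k with _ | k
    · obtain ⟨h, q, hq, hq'⟩ := h
      exact ⟨hT, q, hq', hq⟩
    · obtain ⟨h, T'', hT'', q, hq, hq'⟩ := h
      have h1 : T'' ∈ P.star T' 1 := ⟨star_subset_simplices hT'', q, hq', hq⟩
      have := star_trans h1 (ih hT'')
      rwa [add_comm] at this

theorem exists_mem_star_one {s T : Finset (EuclideanSpace ℝ (Fin d))} {k : ℕ}
    (h : T ∈ P.star s (k + 2)) : ∃ T₁ ∈ P.star s 1, T ∈ P.star T₁ (k + 1) := by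
  induction k generalizing T with
  | zero =>
    obtain ⟨hT, T', hT', q, hq, hq'⟩ := h
    exact ⟨T', hT', hT, q, hq, hq'⟩
  | succ k ih =>
    obtain ⟨hT, T', hT', q, hq, hq'⟩ := h
    obtain ⟨T₁, h₁, h₂⟩ := ih hT'
    exact ⟨T₁, h₁, mem_star_succ hT h₂ hq hq'⟩

/-- Turns geometric disjointness into combinatorial distance: a chain from `p` to `T` would start
with a simplex of `star^1(p)` that by symmetry also lies in `star^k(T)`. -/
theorem notMem_star_of_disjoint {p : EuclideanSpace ℝ (Fin d)}
    {T : Finset (EuclideanSpace ℝ (Fin d))} {k : ℕ} (hk : 1 ≤ k)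
    (h : Disjoint (P.starSet T k) (P.starSet {p} 1)) : T ∉ P.star {p} (k + 1) := by
  intro hmem
  obtain ⟨k, rfl⟩ := Nat.exists_eq_add_of_le' hk
  obtain ⟨T₁, h₁, h₂⟩ := exists_mem_star_one hmem
  have h₃ := star_symm (star_subset_simplices h₁) h₂
  obtain ⟨q, hq⟩ := nonempty_of_mem_simplices (star_subset_simplices h₁)
  have hq' := subset_convexHull ℝ (T₁ : Set (EuclideanSpace ℝ (Fin d))) hq
  exact Set.disjoint_left.1 h (mem_biUnion h₃ hq') (mem_biUnion h₁ hq')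

/-- Face-to-face contact forces a common vertex, so passing from a point of a star to a simplex
containing it costs one ring. This is the source of the `+ 1` terms in later star indices. -/
theorem mem_star_of_mem_starSet {s T : Finset (EuclideanSpace ℝ (Fin d))} {k : ℕ}
    {x : EuclideanSpace ℝ (Fin d)} (hT : T ∈ P.simplices)
    (hx : x ∈ convexHull ℝ (T : Set (EuclideanSpace ℝ (Fin d)))) (h : x ∈ P.starSet s k) :
    T ∈ P.star s (k + 1) := by
  obtain ⟨T', hT', hxT'⟩ := mem_iUnion₂.1 h
  obtain ⟨q, hq, hq'⟩ := exists_common_vertex hT (star_subset_simplices hT') hx hxT'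
  exact mem_star_succ hT hT' hq hq'

/-! ### The domain -/

theorem mem_domain_iff {x : EuclideanSpace ℝ (Fin d)} : x ∈ P.domain ↔
    ∃ T ∈ P.simplices, x ∈ convexHull ℝ (T : Set (EuclideanSpace ℝ (Fin d))) := by
  constructor
  · intro hx
    obtain ⟨s, hs, hxs⟩ := P.complex.mem_space_iff.1 hx
    obtain ⟨T, hT, hsT, hc⟩ := P.pure s hs
    exact ⟨T, ⟨hT, hc⟩, convexHull_mono (by exact_mod_cast hsT) hxs⟩
  · rintro ⟨T, hT, hx⟩
    exact P.complex.mem_space_iff.2 ⟨T, hT.1, hx⟩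

theorem domain_eq : P.domain =
    ⋃ T ∈ P.simplices, convexHull ℝ (T : Set (EuclideanSpace ℝ (Fin d))) := by
  ext x
  simp only [mem_domain_iff, mem_iUnion, exists_prop]

theorem hull_subset_domain {T : Finset (EuclideanSpace ℝ (Fin d))} (hT : T ∈ P.simplices) :
    convexHull ℝ (T : Set (EuclideanSpace ℝ (Fin d))) ⊆ P.domain :=
  fun _ hx => mem_domain_iff.2 ⟨T, hT, hx⟩

theorem isCompact_hull (T : Finset (EuclideanSpace ℝ (Fin d))) :
    IsCompact (convexHull ℝ (T : Set (EuclideanSpace ℝ (Fin d)))) :=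
  T.finite_toSet.isCompact_convexHull ℝ

theorem isCompact_starSet {s : Finset (EuclideanSpace ℝ (Fin d))} {k : ℕ} :
    IsCompact (P.starSet s k) :=
  (P.simplices_finite.subset star_subset_simplices).isCompact_biUnion fun T _ => isCompact_hull T

theorem starSet_subset_domain {s : Finset (EuclideanSpace ℝ (Fin d))} {k : ℕ} :
    P.starSet s k ⊆ P.domain :=
  iUnion₂_subset fun _ hT => hull_subset_domain (star_subset_simplices hT)

variable (P) in
theorem isCompact_domain : IsCompact P.domain := by
  rw [domain_eq]
  exact P.simplices_finite.isCompact_biUnion fun T _ => isCompact_hull T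

variable (P) in
theorem ae_mem_interior : ∀ᵐ x ∂(volume.restrict P.domain), ∃ T ∈ P.simplices,
    x ∈ interior (convexHull ℝ (T : Set (EuclideanSpace ℝ (Fin d)))) := by
  rw [ae_restrict_iff' P.isCompact_domain.measurableSet]
  have : ∀ᵐ x ∂(volume : Measure (EuclideanSpace ℝ (Fin d))), ∀ T ∈ P.simplices,
      x ∉ frontier (convexHull ℝ (T : Set (EuclideanSpace ℝ (Fin d)))) := by
    rw [ae_ball_iff P.simplices_finite.countable]
    intro T _
    exact measure_eq_zero_iff_ae_notMem.1 ((convex_convexHull ℝ _).addHaar_frontier volume)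
  filter_upwards [this] with x hx hxd
  obtain ⟨T, hT, hxT⟩ := mem_domain_iff.1 hxd
  refine ⟨T, hT, ?_⟩
  by_contra h
  exact hx T hT ⟨subset_closure hxT, h⟩

variable (P) in
theorem domain_ae_eq : P.domain =ᵐ[volume]
    ⋃ T ∈ P.simplices, interior (convexHull ℝ (T : Set (EuclideanSpace ℝ (Fin d)))) := by
  have h := P.ae_mem_interior
  rw [ae_restrict_iff' P.isCompact_domain.measurableSet] at h
  filter_upwards [h] with x hx
  apply propext
  constructor
  · intro hxd
    obtain ⟨T, hT, hxT⟩ := hx hxd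
    exact mem_biUnion hT hxT
  · intro hxd
    obtain ⟨T, hT, hxT⟩ := mem_iUnion₂.1 hxd
    exact hull_subset_domain hT (interior_subset hxT)

/-- The finitely many closed simplices that miss `x` also miss a neighbourhood of `x`. -/
theorem eventually_exists_hull (x : EuclideanSpace ℝ (Fin d)) :
    ∀ᶠ y in nhds x, y ∈ P.domain → ∃ T ∈ P.simplices,
      x ∈ convexHull ℝ (T : Set (EuclideanSpace ℝ (Fin d))) ∧
      y ∈ convexHull ℝ (T : Set (EuclideanSpace ℝ (Fin d))) := by
  have : ∀ᶠ y in nhds x, ∀ T ∈ P.simplices,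
      x ∉ convexHull ℝ (T : Set (EuclideanSpace ℝ (Fin d))) →
      y ∉ convexHull ℝ (T : Set (EuclideanSpace ℝ (Fin d))) := by
    rw [Filter.eventually_all_finite P.simplices_finite]
    intro T _
    by_cases hx : x ∈ convexHull ℝ (T : Set (EuclideanSpace ℝ (Fin d)))
    · simp [hx]
    · filter_upwards [(isCompact_hull T).isClosed.isOpen_compl.mem_nhds hx] with y hy _ using hy
  filter_upwards [this] with y hy hyd
  obtain ⟨T, hT, hyT⟩ := mem_domain_iff.1 hyd
  exact ⟨T, hT, by_contra fun h => hy T hT h hyT, hyT⟩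

/-! ### Mesh size and inscribed balls -/

theorem dist_le_meshSize {T : Finset (EuclideanSpace ℝ (Fin d))} (hT : T ∈ P.simplices)
    {x y : EuclideanSpace ℝ (Fin d)}
    (hx : x ∈ convexHull ℝ (T : Set (EuclideanSpace ℝ (Fin d))))
    (hy : y ∈ convexHull ℝ (T : Set (EuclideanSpace ℝ (Fin d)))) : dist x y ≤ P.meshSize :=
  (Metric.dist_le_diam_of_mem (isCompact_hull T).isBounded hx hy).trans
    (le_csSup (P.simplices_finite.image _).bddAbove (mem_image_of_mem _ hT))

theorem meshSize_pos (hd : 1 ≤ d) {T : Finset (EuclideanSpace ℝ (Fin d))}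
    (hT : T ∈ P.simplices) : 0 < P.meshSize := by
  have : 1 < T.card := by rw [hT.2]; omega
  obtain ⟨x, hx, y, hy, hxy⟩ := Finset.one_lt_card.1 this
  exact (dist_pos.2 hxy).trans_le
    (dist_le_meshSize hT (subset_convexHull ℝ _ hx) (subset_convexHull ℝ _ hy))

theorem QuasiUniform.exists_ball {β : ℝ} (h : P.QuasiUniform β) (hd : 1 ≤ d)
    {T : Finset (EuclideanSpace ℝ (Fin d))} (hT : T ∈ P.simplices) :
    0 < β ∧ ∃ c, ∃ ρ > 0, Metric.closedBall c ρ ⊆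
      convexHull ℝ (T : Set (EuclideanSpace ℝ (Fin d))) ∧ P.meshSize ≤ 2 * β * ρ := by
  have h0 := meshSize_pos hd hT
  have h1 := h T hT
  obtain ⟨q, hq⟩ := nonempty_of_mem_simplices hT
  have hmem : (0 : ℝ) ∈ {ρ : ℝ | ∃ x, Metric.closedBall x ρ ⊆
      convexHull ℝ (T : Set (EuclideanSpace ℝ (Fin d)))} :=
    ⟨q, by simpa using subset_convexHull ℝ (T : Set (EuclideanSpace ℝ (Fin d))) hq⟩
  have h2 : 0 ≤ inradius T := Real.sSup_nonneg' ⟨0, hmem, le_rfl⟩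
  have h3 : 0 < inradius T := h2.lt_of_ne fun h => by rw [← h] at h1; linarith
  have h4 : 0 < β := pos_of_mul_pos_left (h0.trans_le h1) h2
  -- A radius above half the supremum suffices, so attainment of the inradius is not needed; the
  -- price is the factor 2.
  obtain ⟨ρ, ⟨c, hc⟩, hρ⟩ := exists_lt_of_lt_csSup ⟨0, hmem⟩ (half_lt_self h3)
  have hρ' : inradius T < 2 * ρ := by rw [inradius]; linarith
  refine ⟨h4, c, ρ, by linarith, hc, h1.trans ?_⟩
  nlinarith

end SimplicialPartition

/-! ### Polynomial functions -/

/-- The function on `ℝ^d` defined by a polynomial. -/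
def polyFun {d : ℕ} (p : MvPolynomial (Fin d) ℝ) (x : EuclideanSpace ℝ (Fin d)) : ℝ :=
  MvPolynomial.eval (fun j => x j) p

theorem contDiff_polyFun {d : ℕ} (p : MvPolynomial (Fin d) ℝ) : ContDiff ℝ 1 (polyFun p) := by
  have h := AnalyticOnNhd.eval_continuousLinearMap' (𝕜 := ℝ) (E := EuclideanSpace ℝ (Fin d))
    (fun j : Fin d => EuclideanSpace.proj j) p
  exact contDiffOn_univ.1 (h.contDiffOn uniqueDiffOn_univ)

theorem differentiable_polyFun {d : ℕ} (p : MvPolynomial (Fin d) ℝ) :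
    Differentiable ℝ (polyFun p) := (contDiff_polyFun p).differentiable one_ne_zero

theorem continuous_polyFun {d : ℕ} (p : MvPolynomial (Fin d) ℝ) : Continuous (polyFun p) :=
  (contDiff_polyFun p).continuous

theorem continuous_gradient_of_contDiff {d : ℕ} {f : EuclideanSpace ℝ (Fin d) → ℝ}
    (hf : ContDiff ℝ 1 f) : Continuous (gradient f) :=
  (LinearIsometryEquiv.continuous _).comp (hf.continuous_fderiv one_ne_zero)

theorem gradient_add_of_differentiableAt {d : ℕ} {f g : EuclideanSpace ℝ (Fin d) → ℝ}
    {x : EuclideanSpace ℝ (Fin d)} (hf : DifferentiableAt ℝ f x) (hg : DifferentiableAt ℝ g x) :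
    gradient (f + g) x = gradient f x + gradient g x := by
  simp only [gradient, fderiv_add hf hg, map_add]

theorem gradient_smul_of_differentiableAt {d : ℕ} {f : EuclideanSpace ℝ (Fin d) → ℝ}
    {x : EuclideanSpace ℝ (Fin d)} (c : ℝ) (hf : DifferentiableAt ℝ f x) :
    gradient (c • f) x = c • gradient f x := by
  simp only [gradient, fderiv_const_smul hf c]
  exact LinearIsometryEquiv.map_smul _ _

namespace SimplicialPartition

variable {d : ℕ} {P : SimplicialPartition d}

/-! ### The spline space and the Dirichlet form -/

theorem IsSpline.exists_polyFun {r n : ℕ} {u : EuclideanSpace ℝ (Fin d) → ℝ}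
    (hu : P.IsSpline r n u) {T : Finset (EuclideanSpace ℝ (Fin d))} (hT : T ∈ P.simplices) :
    ∃ p : MvPolynomial (Fin d) ℝ, p.totalDegree ≤ n ∧
      (∀ x ∈ convexHull ℝ (T : Set (EuclideanSpace ℝ (Fin d))), u x = polyFun p x) ∧
      ∀ x ∈ interior (convexHull ℝ (T : Set (EuclideanSpace ℝ (Fin d)))),
        u =ᶠ[nhds x] polyFun p := by
  obtain ⟨p, hp, h⟩ := hu.2.2 T hT
  refine ⟨p, hp, h, fun x hx => ?_⟩
  filter_upwards [isOpen_interior.mem_nhds hx] with y hy using h y (interior_subset hy)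

theorem IsSpline.differentiableAt {r n : ℕ} {u : EuclideanSpace ℝ (Fin d) → ℝ}
    (hu : P.IsSpline r n u) {T : Finset (EuclideanSpace ℝ (Fin d))} (hT : T ∈ P.simplices)
    {x : EuclideanSpace ℝ (Fin d)}
    (hx : x ∈ interior (convexHull ℝ (T : Set (EuclideanSpace ℝ (Fin d))))) :
    DifferentiableAt ℝ u x := by
  obtain ⟨p, -, -, h⟩ := hu.exists_polyFun hT
  exact (differentiable_polyFun p x).congr_of_eventuallyEq (h x hx)

theorem gradient_eq_zero_of_eqOn {u : EuclideanSpace ℝ (Fin d) → ℝ} {s : Set _} (c : ℝ)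
    (hu : ∀ x ∈ s, u x = c) {x : EuclideanSpace ℝ (Fin d)} (hx : x ∈ interior s) :
    gradient u x = 0 := by
  have : u =ᶠ[nhds x] fun _ => c := by
    filter_upwards [isOpen_interior.mem_nhds hx] with y hy using hu y (interior_subset hy)
  rw [this.gradient_eq, gradient_fun_const]

theorem IsSpline.integrableOn_inner {r n : ℕ} {u v : EuclideanSpace ℝ (Fin d) → ℝ}
    (hu : P.IsSpline r n u) (hv : P.IsSpline r n v) :
    IntegrableOn (fun x => inner ℝ (gradient u x) (gradient v x)) P.domain := by
  rw [IntegrableOn, Measure.restrict_congr_set P.domain_ae_eq, ← IntegrableOn,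
    integrableOn_finite_biUnion P.simplices_finite]
  intro T hT
  obtain ⟨p, -, -, hp⟩ := hu.exists_polyFun hT
  obtain ⟨q, -, -, hq⟩ := hv.exists_polyFun hT
  have : IntegrableOn (fun x => inner ℝ (gradient (polyFun p) x) (gradient (polyFun q) x))
      (interior (convexHull ℝ (T : Set (EuclideanSpace ℝ (Fin d))))) := by
    refine IntegrableOn.mono_set ?_ interior_subset
    exact ((continuous_gradient_of_contDiff (contDiff_polyFun p)).inner
      (continuous_gradient_of_contDiff (contDiff_polyFun q))).continuousOn.integrableOn_compact
      (isCompact_hull T)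
  refine this.congr_fun (fun x hx => ?_) isOpen_interior.measurableSet
  simp only [(hp x hx).gradient_eq, (hq x hx).gradient_eq]

variable (P) in
/-- The spline space as a space of functions. -/
def splineSpace (r n : ℕ) : Submodule ℝ (EuclideanSpace ℝ (Fin d) → ℝ) where
  carrier := {u | P.IsSpline r n u}
  zero_mem' := ⟨continuousOn_const, contDiffOn_const, fun _ _ => ⟨0, by simp, by simp⟩⟩
  add_mem' := by
    rintro u v ⟨h1, h2, h3⟩ ⟨h1', h2', h3'⟩
    refine ⟨h1.add h1', h2.add h2', fun T hT => ?_⟩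
    obtain ⟨p, hp, hpu⟩ := h3 T hT
    obtain ⟨q, hq, hqv⟩ := h3' T hT
    refine ⟨p + q, (MvPolynomial.totalDegree_add _ _).trans (max_le hp hq), fun x hx => ?_⟩
    rw [Pi.add_apply, hpu x hx, hqv x hx, map_add]
  smul_mem' := by
    rintro c u ⟨h1, h2, h3⟩
    refine ⟨h1.const_smul c, h2.const_smul c, fun T hT => ?_⟩
    obtain ⟨p, hp, hpu⟩ := h3 T hT
    refine ⟨c • p, (MvPolynomial.totalDegree_smul_le _ _).trans hp, fun x hx => ?_⟩
    rw [Pi.smul_apply, hpu x hx, MvPolynomial.smul_eval, smul_eq_mul]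

theorem mem_splineSpace {r n : ℕ} {u : EuclideanSpace ℝ (Fin d) → ℝ} :
    u ∈ P.splineSpace r n ↔ P.IsSpline r n u := Iff.rfl

variable (P) in
/-- The Dirichlet form `∫_Ω ∇u · ∇v` on the spline space. -/
def dirichlet (r n : ℕ) : LinearMap.BilinForm ℝ (P.splineSpace r n) :=
  LinearMap.mk₂ ℝ
    (fun u v => ∫ x in P.domain, inner ℝ (gradient (u : EuclideanSpace ℝ (Fin d) → ℝ) x)
      (gradient (v : EuclideanSpace ℝ (Fin d) → ℝ) x))
    (fun u u' v => by
      rw [← integral_add (u.2.integrableOn_inner v.2) (u'.2.integrableOn_inner v.2)]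
      refine integral_congr_ae ?_
      filter_upwards [P.ae_mem_interior] with x ⟨T, hT, hx⟩
      rw [Submodule.coe_add, gradient_add_of_differentiableAt
        (IsSpline.differentiableAt u.2 hT hx) (IsSpline.differentiableAt u'.2 hT hx),
        inner_add_left])
    (fun c u v => by
      rw [smul_eq_mul, ← integral_const_mul]
      refine integral_congr_ae ?_
      filter_upwards [P.ae_mem_interior] with x ⟨T, hT, hx⟩
      rw [Submodule.coe_smul, gradient_smul_of_differentiableAt c
        (IsSpline.differentiableAt u.2 hT hx), real_inner_smul_left])
    (fun u v v' => by
      rw [← integral_add (u.2.integrableOn_inner v.2) (u.2.integrableOn_inner v'.2)]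
      refine integral_congr_ae ?_
      filter_upwards [P.ae_mem_interior] with x ⟨T, hT, hx⟩
      rw [Submodule.coe_add, gradient_add_of_differentiableAt
        (IsSpline.differentiableAt v.2 hT hx) (IsSpline.differentiableAt v'.2 hT hx),
        inner_add_right])
    (fun c u v => by
      rw [smul_eq_mul, ← integral_const_mul]
      refine integral_congr_ae ?_
      filter_upwards [P.ae_mem_interior] with x ⟨T, hT, hx⟩
      rw [Submodule.coe_smul, gradient_smul_of_differentiableAt c
        (IsSpline.differentiableAt v.2 hT hx), real_inner_smul_right])

theorem dirichlet_apply {r n : ℕ} (u v : P.splineSpace r n) : P.dirichlet r n u v =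
    ∫ x in P.domain, inner ℝ (gradient (u : EuclideanSpace ℝ (Fin d) → ℝ) x)
      (gradient (v : EuclideanSpace ℝ (Fin d) → ℝ) x) := rfl

theorem dirichlet_self {r n : ℕ} (u : P.splineSpace r n) :
    P.dirichlet r n u u = P.energy u := by
  simp only [dirichlet_apply, real_inner_self_eq_norm_sq, energy]

theorem dirichlet_self_nonneg {r n : ℕ} (u : P.splineSpace r n) : 0 ≤ P.dirichlet r n u u := by
  rw [dirichlet_self]
  exact integral_nonneg fun x => sq_nonneg _

theorem dirichlet_comm {r n : ℕ} (u v : P.splineSpace r n) :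
    P.dirichlet r n u v = P.dirichlet r n v u := by
  simp only [dirichlet_apply]
  exact integral_congr_ae (.of_forall fun x => real_inner_comm _ _)

theorem dirichlet_eq_zero {r n : ℕ} {u v : P.splineSpace r n}
    (h : ∀ T ∈ P.simplices,
      (∀ x ∈ convexHull ℝ (T : Set (EuclideanSpace ℝ (Fin d))), u.1 x = 0) ∨
      ∀ x ∈ convexHull ℝ (T : Set (EuclideanSpace ℝ (Fin d))), v.1 x = 0) :
    P.dirichlet r n u v = 0 := by
  rw [dirichlet_apply]
  refine integral_eq_zero_of_ae ?_
  filter_upwards [P.ae_mem_interior] with x ⟨T, hT, hx⟩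
  rcases h T hT with h | h
  · simp [gradient_eq_zero_of_eqOn 0 h hx]
  · simp [gradient_eq_zero_of_eqOn 0 h hx]

/-- A simplex on which both functions are nonzero somewhere lies within `j + 1` rings of `s` and `k
+ 1` rings of `t`; hence the interaction range `j + k + 2`. -/
theorem dirichlet_eq_zero_of_star {r n : ℕ} {u v : P.splineSpace r n}
    {s t : Finset (EuclideanSpace ℝ (Fin d))} {j k : ℕ}
    (hu : ∀ x ∈ P.domain, x ∉ P.starSet s j → u.1 x = 0)
    (hv : ∀ x ∈ P.domain, x ∉ P.starSet t k → v.1 x = 0) (ht : t ∈ P.simplices)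
    (h : t ∉ P.star s (j + k + 2)) : P.dirichlet r n u v = 0 := by
  refine dirichlet_eq_zero fun T hT => ?_
  by_contra! hne
  obtain ⟨⟨x, hx, hux⟩, y, hy, hvy⟩ := hne
  have h1 := by_contra fun h' => hux (hu x (hull_subset_domain hT hx) h')
  have h2 := by_contra fun h' => hvy (hv y (hull_subset_domain hT hy) h')
  have h3 := star_trans (mem_star_of_mem_starSet hT hx h1)
    (star_symm ht (mem_star_of_mem_starSet hT hy h2))
  rw [show j + 1 + (k + 1) = j + k + 2 by omega] at h3
  exact h h3

theorem energy_congr {u v : EuclideanSpace ℝ (Fin d) → ℝ} (h : ∀ x ∈ P.domain, u x = v x) :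
    P.energy u = P.energy v := by
  refine integral_congr_ae ?_
  filter_upwards [P.ae_mem_interior] with x ⟨T, hT, hx⟩
  have : u =ᶠ[nhds x] v := by
    filter_upwards [isOpen_interior.mem_nhds hx] with y hy
      using h y (hull_subset_domain hT (interior_subset hy))
  rw [this.gradient_eq]

theorem setIntegral_le_energy {r n : ℕ} {u : EuclideanSpace ℝ (Fin d) → ℝ}
    (hu : P.IsSpline r n u) {T : Finset (EuclideanSpace ℝ (Fin d))} (hT : T ∈ P.simplices)
    {p : MvPolynomial (Fin d) ℝ}
    (hp : ∀ x ∈ convexHull ℝ (T : Set (EuclideanSpace ℝ (Fin d))), u x = polyFun p x)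
    {s : Set (EuclideanSpace ℝ (Fin d))} (hs : IsOpen s)
    (hsT : s ⊆ convexHull ℝ (T : Set (EuclideanSpace ℝ (Fin d)))) :
    ∫ x in s, ‖gradient (polyFun p) x‖ ^ 2 ≤ P.energy u := by
  have h1 : ∫ x in s, ‖gradient (polyFun p) x‖ ^ 2 = ∫ x in s, ‖gradient u x‖ ^ 2 := by
    refine setIntegral_congr_fun hs.measurableSet fun x hx => ?_
    have : u =ᶠ[nhds x] polyFun p := by
      filter_upwards [hs.mem_nhds hx] with y hy using hp y (hsT hy)
    simp only [this.gradient_eq]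
  rw [h1]
  have hi := hu.integrableOn_inner hu
  simp only [real_inner_self_eq_norm_sq] at hi
  exact setIntegral_mono_set hi (.of_forall fun x => sq_nonneg _)
    (hsT.trans (hull_subset_domain hT)).eventuallyLE

end SimplicialPartition

/-! ### Coercivity of definite forms in finite dimension -/

/-- The quadratic form is continuous in the coefficients, attains its extrema on the compact
Euclidean unit sphere, and extends by homogeneity; definiteness makes the minimum positive. -/
theorem exists_coercive {ι V : Type*} [Fintype ι] [AddCommGroup V] [Module ℝ V]
    (D : LinearMap.BilinForm ℝ V) (B : ι → V)
    (hD : ∀ a : ι → ℝ, a ≠ 0 → 0 < D (∑ i, a i • B i) (∑ i, a i • B i)) :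
    ∃ C₁ > 0, ∃ C₂ : ℝ, ∀ a : ι → ℝ, C₁ * ∑ i, a i ^ 2 ≤ D (∑ i, a i • B i) (∑ i, a i • B i) ∧
      D (∑ i, a i • B i) (∑ i, a i • B i) ≤ C₂ * ∑ i, a i ^ 2 := by
  set Q : (ι → ℝ) → ℝ := fun a => D (∑ i, a i • B i) (∑ i, a i • B i) with hQ
  have hQc : Continuous Q := by
    simp only [hQ, map_sum, LinearMap.sum_apply, map_smul, LinearMap.smul_apply, smul_eq_mul]
    fun_prop
  have hQs : ∀ (t : ℝ) a, Q (t • a) = t ^ 2 * Q a := by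
    intro t a
    simp only [hQ, Pi.smul_apply, smul_eq_mul, mul_smul, ← Finset.smul_sum, map_smul,
      LinearMap.smul_apply]
    ring
  set K : Set (ι → ℝ) := {a | ∑ i, a i ^ 2 = 1} with hK
  have hKc : IsCompact K := by
    refine Metric.isCompact_of_isClosed_isBounded
      (isClosed_eq (by fun_prop) continuous_const) ?_
    refine (Metric.isBounded_closedBall (x := (0 : ι → ℝ)) (r := 1)).subset fun a ha => ?_
    rw [mem_closedBall_zero_iff, pi_norm_le_iff_of_nonneg zero_le_one]
    intro i
    have h1 : a i ^ 2 ≤ ∑ i, a i ^ 2 :=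
      Finset.single_le_sum (f := fun i => a i ^ 2) (fun i _ => sq_nonneg _) (Finset.mem_univ i)
    rw [show ∑ i, a i ^ 2 = 1 from ha] at h1
    exact abs_le_one_iff_mul_self_le_one.2 (by nlinarith)
  have key : ∀ a : ι → ℝ, a ≠ 0 → 0 < ∑ i, a i ^ 2 ∧
      ∃ b ∈ K, Q a = (∑ i, a i ^ 2) * Q b := by
    intro a ha
    obtain ⟨j, hj⟩ := Function.ne_iff.1 ha
    have hpos : 0 < ∑ i, a i ^ 2 := Finset.sum_pos' (fun i _ => sq_nonneg _)
      ⟨j, Finset.mem_univ _, by have : a j ≠ 0 := hj; positivity⟩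
    have hs := Real.sq_sqrt hpos.le
    have hs0 := Real.sqrt_pos.2 hpos
    refine ⟨hpos, (√(∑ i, a i ^ 2))⁻¹ • a, ?_, ?_⟩
    · simp only [hK, mem_ofPred_eq, Pi.smul_apply, smul_eq_mul, mul_pow, ← Finset.mul_sum, inv_pow,
        hs]
      exact inv_mul_cancel₀ hpos.ne'
    · rw [hQs, inv_pow, hs, ← mul_assoc, mul_inv_cancel₀ hpos.ne', one_mul]
  have h0 : Q 0 = 0 := by simpa using hQs 0 0
  by_cases hne : K.Nonempty
  · obtain ⟨b₁, hb₁, h₁⟩ := hKc.exists_isMinOn hne hQc.continuousOn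
    obtain ⟨b₂, hb₂, h₂⟩ := hKc.exists_isMaxOn hne hQc.continuousOn
    have hb₁0 : b₁ ≠ 0 := by
      rintro rfl
      simp [hK] at hb₁
    refine ⟨Q b₁, hD b₁ hb₁0, Q b₂, fun a => ?_⟩
    by_cases ha : a = 0
    · subst ha
      change _ ≤ Q 0 ∧ Q 0 ≤ _
      simp [h0]
    · obtain ⟨hpos, b, hb, hab⟩ := key a ha
      change _ ≤ Q a ∧ Q a ≤ _
      rw [hab, mul_comm (Q b₁), mul_comm (Q b₂)]
      exact ⟨mul_le_mul_of_nonneg_left (h₁ hb) hpos.le, mul_le_mul_of_nonneg_left (h₂ hb) hpos.le⟩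
  -- The sphere is empty only if zero is the sole coefficient vector, and then any constants work.
  · refine ⟨1, one_pos, 1, fun a => ?_⟩
    have ha : a = 0 := by
      by_contra ha
      obtain ⟨-, b, hb, -⟩ := key a ha
      exact hne ⟨b, hb⟩
    subst ha
    change _ ≤ Q 0 ∧ Q 0 ≤ _
    simp [h0]

/-! ### The inverse inequality for polynomials -/

theorem eq_of_setIntegral_gradient_eq_zero {d : ℕ} {f : EuclideanSpace ℝ (Fin d) → ℝ}
    (hf : ContDiff ℝ 1 f) {s : Set (EuclideanSpace ℝ (Fin d))} (hs : IsOpen s) (hc : Convex ℝ s)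
    (hb : Bornology.IsBounded s) (h : ∫ x in s, ‖gradient f x‖ ^ 2 = 0)
    {x y : EuclideanSpace ℝ (Fin d)} (hx : x ∈ s) (hy : y ∈ s) : f x = f y := by
  have hcont : Continuous fun x => ‖gradient f x‖ ^ 2 :=
    (continuous_gradient_of_contDiff hf).norm.pow 2
  have hint : IntegrableOn (fun x => ‖gradient f x‖ ^ 2) s :=
    (hcont.continuousOn.integrableOn_compact hb.isCompact_closure).mono_set subset_closure
  have h1 := (integral_eq_zero_iff_of_nonneg (fun x => sq_nonneg _) hint).1 h
  have h2 : EqOn (fun x => ‖gradient f x‖ ^ 2) 0 s :=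
    Measure.eqOn_open_of_ae_eq h1 hs hcont.continuousOn continuousOn_const
  refine hs.is_const_of_fderiv_eq_zero hc.isPreconnected
    (hf.differentiable one_ne_zero).differentiableOn (fun z hz => ?_) hx hy
  have h3 : gradient f z = 0 := by simpa using h2 hz
  rw [← toDual_gradient, h3, map_zero]
  rfl

theorem eq_zero_of_polyFun_eq_zero {d : ℕ} {p : MvPolynomial (Fin d) ℝ}
    {s : Set (EuclideanSpace ℝ (Fin d))} (hs : s ∈ nhds 0) (h : ∀ x ∈ s, polyFun p x = 0) :
    p = 0 := by
  have hc : Continuous (fun y : Fin d → ℝ => WithLp.toLp 2 y) := PiLp.continuous_toLp 2 _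
  have h1 := hc.continuousAt.preimage_mem_nhds (x := 0) (t := s) (by simpa using hs)
  obtain ⟨ε, hε, hball⟩ := Metric.mem_nhds_iff.1 h1
  refine MvPolynomial.funext_set (fun _ => Metric.ball (0 : ℝ) ε) (fun _ => ?_) fun y hy => ?_
  · rw [Real.ball_eq_Ioo]
    exact Ioo_infinite (by linarith)
  · have h2 : y ∈ Metric.ball (0 : Fin d → ℝ) ε := by
      rw [ball_pi _ hε]
      exact hy
    simpa [polyFun] using h _ (hball h2)

theorem integrableOn_ball_inner_gradient {d : ℕ} (p q : MvPolynomial (Fin d) ℝ)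
    (c : EuclideanSpace ℝ (Fin d)) (ρ : ℝ) :
    IntegrableOn (fun x => inner ℝ (gradient (polyFun p) x) (gradient (polyFun q) x))
      (Metric.ball c ρ) :=
  (((continuous_gradient_of_contDiff (contDiff_polyFun p)).inner
    (continuous_gradient_of_contDiff (contDiff_polyFun q))).continuousOn.integrableOn_compact
      (isCompact_closedBall c ρ)).mono_set Metric.ball_subset_closedBall

theorem polyFun_add {d : ℕ} (p q : MvPolynomial (Fin d) ℝ) :
    polyFun (p + q) = polyFun p + polyFun q := by
  ext x; simp [polyFun]

theorem polyFun_smul {d : ℕ} (c : ℝ) (p : MvPolynomial (Fin d) ℝ) :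
    polyFun (c • p) = c • polyFun p := by
  ext x; simp [polyFun]

theorem polyFun_sum_smul {d : ℕ} {ι : Type*} (s : Finset ι) (a : ι → ℝ)
    (b : ι → MvPolynomial (Fin d) ℝ) (x : EuclideanSpace ℝ (Fin d)) :
    polyFun (∑ i ∈ s, a i • b i) x = ∑ i ∈ s, a i * polyFun (b i) x := by
  simp [polyFun, map_sum]

/-- The `H¹`-type form `∫_{B(0,1)} ∇p · ∇q + p(0) q(0)` on polynomials. -/
def ballForm (d : ℕ) : LinearMap.BilinForm ℝ (MvPolynomial (Fin d) ℝ) :=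
  LinearMap.mk₂ ℝ
    (fun p q => (∫ x in Metric.ball 0 1, inner ℝ (gradient (polyFun p) x)
      (gradient (polyFun q) x)) + polyFun p 0 * polyFun q 0)
    (fun p p' q => by
      have : ∀ x, inner ℝ (gradient (polyFun (p + p')) x) (gradient (polyFun q) x) =
          inner ℝ (gradient (polyFun p) x) (gradient (polyFun q) x) +
          inner ℝ (gradient (polyFun p') x) (gradient (polyFun q) x) := fun x => by
        rw [polyFun_add, gradient_add_of_differentiableAt (differentiable_polyFun p x)
          (differentiable_polyFun p' x), inner_add_left]
      simp only [this]
      rw [integral_add (integrableOn_ball_inner_gradient _ _ _ _)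
        (integrableOn_ball_inner_gradient _ _ _ _), polyFun_add, Pi.add_apply]
      ring)
    (fun c p q => by
      have : ∀ x, inner ℝ (gradient (polyFun (c • p)) x) (gradient (polyFun q) x) =
          c * inner ℝ (gradient (polyFun p) x) (gradient (polyFun q) x) := fun x => by
        rw [polyFun_smul, gradient_smul_of_differentiableAt c (differentiable_polyFun p x),
          real_inner_smul_left]
      simp only [this]
      rw [integral_const_mul, polyFun_smul, Pi.smul_apply]
      simp only [smul_eq_mul]
      ring)
    (fun p q q' => by
      have : ∀ x, inner ℝ (gradient (polyFun p) x) (gradient (polyFun (q + q')) x) =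
          inner ℝ (gradient (polyFun p) x) (gradient (polyFun q) x) +
          inner ℝ (gradient (polyFun p) x) (gradient (polyFun q') x) := fun x => by
        rw [polyFun_add, gradient_add_of_differentiableAt (differentiable_polyFun q x)
          (differentiable_polyFun q' x), inner_add_right]
      simp only [this]
      rw [integral_add (integrableOn_ball_inner_gradient _ _ _ _)
        (integrableOn_ball_inner_gradient _ _ _ _), polyFun_add, Pi.add_apply]
      ring)
    (fun c p q => by
      have : ∀ x, inner ℝ (gradient (polyFun p) x) (gradient (polyFun (c • q)) x) =
          c * inner ℝ (gradient (polyFun p) x) (gradient (polyFun q) x) := fun x => by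
        rw [polyFun_smul, gradient_smul_of_differentiableAt c (differentiable_polyFun q x),
          real_inner_smul_right]
      simp only [this]
      rw [integral_const_mul, polyFun_smul, Pi.smul_apply]
      simp only [smul_eq_mul]
      ring)

theorem ballForm_self {d : ℕ} (p : MvPolynomial (Fin d) ℝ) : ballForm d p p =
    (∫ x in Metric.ball 0 1, ‖gradient (polyFun p) x‖ ^ 2) + polyFun p 0 ^ 2 := by
  simp only [ballForm, LinearMap.mk₂_apply, real_inner_self_eq_norm_sq, sq (polyFun p 0)]

/-- The gradient integral detects everything but constants, and the point value at the centre
detects those. -/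
theorem ballForm_self_pos {d : ℕ} {p : MvPolynomial (Fin d) ℝ} (hp : p ≠ 0) :
    0 < ballForm d p p := by
  rw [ballForm_self]
  have h1 : 0 ≤ ∫ x in Metric.ball (0 : EuclideanSpace ℝ (Fin d)) 1,
      ‖gradient (polyFun p) x‖ ^ 2 := integral_nonneg fun x => sq_nonneg _
  by_contra! hle
  have h2 : polyFun p 0 = 0 := by nlinarith [sq_nonneg (polyFun p 0)]
  have h3 : ∫ x in Metric.ball (0 : EuclideanSpace ℝ (Fin d)) 1,
      ‖gradient (polyFun p) x‖ ^ 2 = 0 := by nlinarith [sq_nonneg (polyFun p 0)]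
  refine hp (eq_zero_of_polyFun_eq_zero (Metric.ball_mem_nhds 0 one_pos) fun x hx => ?_)
  rw [← h2]
  exact eq_of_setIntegral_gradient_eq_zero (contDiff_polyFun p) Metric.isOpen_ball
    (convex_ball _ _) Metric.isBounded_ball h3 hx (Metric.mem_ball_self one_pos)

/-- On the finite-dimensional space of degree at most `n`, `ballForm` controls the coefficients in a
basis. For `p - p(0)` the form is just the gradient integral, and Cauchy–Schwarz bounds point values
by coefficients. -/
theorem exists_osc_bound_unit (d n : ℕ) (R : ℝ) : ∃ C > 0, ∀ p : MvPolynomial (Fin d) ℝ,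
    p.totalDegree ≤ n → ∀ z ∈ Metric.closedBall (0 : EuclideanSpace ℝ (Fin d)) R,
      (polyFun p z - polyFun p 0) ^ 2 ≤
        C * ∫ x in Metric.ball 0 1, ‖gradient (polyFun p) x‖ ^ 2 := by
  let b := Module.finBasis ℝ (MvPolynomial.restrictTotalDegree (Fin d) ℝ n)
  have hsum : ∀ a : Fin _ → ℝ, (∑ i, a i • (b i : MvPolynomial (Fin d) ℝ)) =
      ((∑ i, a i • b i : MvPolynomial.restrictTotalDegree (Fin d) ℝ n) :
        MvPolynomial (Fin d) ℝ) := by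
    intro a; simp
  obtain ⟨C₁, hC₁, C₂, hC⟩ := exists_coercive (ballForm d)
    (fun i => (b i : MvPolynomial (Fin d) ℝ)) (by
      intro a ha
      refine ballForm_self_pos fun h0 => ha ?_
      rw [hsum, Submodule.coe_eq_zero] at h0
      have h1 := congrArg b.equivFun h0
      rw [← b.equivFun_symm_apply, LinearEquiv.apply_symm_apply, map_zero] at h1
      exact h1)
  have hcb : Continuous fun z => ∑ i, polyFun (b i : MvPolynomial (Fin d) ℝ) z ^ 2 :=
    continuous_finsetSum _ fun i _ => (continuous_polyFun _).pow 2
  obtain ⟨M, hM⟩ := (isCompact_closedBall (0 : EuclideanSpace ℝ (Fin d)) R).bddAbove_image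
    hcb.continuousOn
  -- `M` bounds the sum of the squared basis values over the large ball and `C₁` is the coercivity
  -- constant.
  refine ⟨(|M| + 1) / C₁, by positivity, fun p hp z hz => ?_⟩
  set q := p - MvPolynomial.C (polyFun p 0) with hq
  have hqdeg : q.totalDegree ≤ n := by
    refine (MvPolynomial.totalDegree_sub _ _).trans (max_le hp ?_)
    simp
  have hqf : polyFun q = fun x => polyFun p x - polyFun p 0 := by
    ext x; simp [hq, polyFun]
  have hgrad : ∀ x, gradient (polyFun q) x = gradient (polyFun p) x := by
    intro x
    simp only [gradient, hqf, fderiv_sub_const]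
  have hq0 : polyFun q 0 = 0 := by rw [hqf]; simp
  let q' : MvPolynomial.restrictTotalDegree (Fin d) ℝ n :=
    ⟨q, (MvPolynomial.mem_restrictTotalDegree _ _ _).2 hqdeg⟩
  have hrep : q = ∑ i, b.equivFun q' i • (b i : MvPolynomial (Fin d) ℝ) := by
    rw [hsum, b.sum_equivFun]
  have h1 := (hC (b.equivFun q')).1
  rw [← hrep, ballForm_self, hq0] at h1
  simp only [hgrad] at h1
  have h2 : polyFun p z - polyFun p 0 = ∑ i, b.equivFun q' i *
      polyFun (b i : MvPolynomial (Fin d) ℝ) z := by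
    rw [← polyFun_sum_smul, ← hrep, hqf]
  have h3 : ∑ i, polyFun (b i : MvPolynomial (Fin d) ℝ) z ^ 2 ≤ |M| + 1 :=
    (hM (mem_image_of_mem _ hz)).trans (by linarith [le_abs_self M])
  rw [h2]
  refine (Finset.sum_mul_sq_le_sq_mul_sq _ _ _).trans ?_
  rw [div_mul_eq_mul_div, le_div_iff₀ hC₁]
  have h4 : 0 ≤ ∑ i, b.equivFun q' i ^ 2 := Finset.sum_nonneg fun i _ => sq_nonneg _
  have h5 : 0 ≤ |M| + 1 := by positivity
  nlinarith [mul_le_mul_of_nonneg_left h3 (mul_nonneg h4 hC₁.le), mul_le_mul_of_nonneg_left h1 h5]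

theorem totalDegree_bind₁_le {σ τ : Type*} (p : MvPolynomial σ ℝ) (f : σ → MvPolynomial τ ℝ)
    (hf : ∀ i, (f i).totalDegree ≤ 1) : (MvPolynomial.bind₁ f p).totalDegree ≤ p.totalDegree := by
  rw [MvPolynomial.bind₁, MvPolynomial.aeval_def, MvPolynomial.eval₂_eq]
  refine MvPolynomial.totalDegree_finsetSum_le fun α hα => ?_
  rw [← Algebra.smul_def]
  refine (MvPolynomial.totalDegree_smul_le _ _).trans ?_
  refine (MvPolynomial.totalDegree_finsetProd _ _).trans ?_
  refine le_trans (Finset.sum_le_sum fun i _ => ?_) (MvPolynomial.le_totalDegree hα)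
  exact (MvPolynomial.totalDegree_pow _ _).trans (by nlinarith [hf i])

/-- Apply the unit-ball bound to `z ↦ p (c + ρ z)`, which has no larger degree. The gradient
contributes `ρ ^ 2` and the volume `ρ ^ d`, so one constant serves all balls. -/
theorem exists_osc_bound (d n : ℕ) (R : ℝ) : ∃ C > 0, ∀ p : MvPolynomial (Fin d) ℝ,
    p.totalDegree ≤ n → ∀ (c : EuclideanSpace ℝ (Fin d)) (ρ : ℝ), 0 < ρ →
      ∀ x ∈ Metric.closedBall c (R * ρ), (polyFun p x - polyFun p c) ^ 2 * ρ ^ d ≤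
        C * ρ ^ 2 * ∫ x in Metric.ball c ρ, ‖gradient (polyFun p) x‖ ^ 2 := by
  obtain ⟨C, hC, h⟩ := exists_osc_bound_unit d n R
  refine ⟨C, hC, fun p hp c ρ hρ x hx => ?_⟩
  let q := MvPolynomial.bind₁
    (fun i => MvPolynomial.C (c i) + MvPolynomial.C ρ * MvPolynomial.X i) p
  have hqdeg : q.totalDegree ≤ n := by
    refine (totalDegree_bind₁_le p _ fun i => ?_).trans hp
    refine (MvPolynomial.totalDegree_add _ _).trans (max_le (by simp) ?_)
    refine (MvPolynomial.totalDegree_mul _ _).trans ?_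
    simp
  have hqf : ∀ z, polyFun q z = polyFun p (c + ρ • z) := by
    intro z
    simp only [q, polyFun, MvPolynomial.eval, MvPolynomial.eval₂Hom_bind₁]
    congr 2
    ext i
    simp
  have hgrad : ∀ z, gradient (polyFun q) z = ρ • gradient (polyFun p) (c + ρ • z) := by
    intro z
    have h1 := (differentiable_polyFun p (c + ρ • z)).hasGradientAt
    have h2 : HasFDerivAt (fun z : EuclideanSpace ℝ (Fin d) => c + ρ • z)
        (ρ • ContinuousLinearMap.id ℝ (EuclideanSpace ℝ (Fin d))) z :=
      ((hasFDerivAt_id z).const_smul ρ).const_add c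
    have h3 := HasFDerivAt.comp z h1.hasFDerivAt h2
    have h4 : HasGradientAt (polyFun q) (ρ • gradient (polyFun p) (c + ρ • z)) z := by
      rw [hasGradientAt_iff_hasFDerivAt]
      have h5 : polyFun q = polyFun p ∘ fun z => c + ρ • z := funext hqf
      rw [h5]
      refine h3.congr_fderiv ?_
      ext y
      simp
    exact h4.gradient
  have h1 := h q hqdeg (ρ⁻¹ • (x - c)) (by
    rw [mem_closedBall_zero_iff, norm_smul, Real.norm_of_nonneg (by positivity),
      inv_mul_le_iff₀ hρ, mul_comm, ← dist_eq_norm]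
    exact hx)
  simp only [hqf, hgrad, smul_zero, add_zero, smul_inv_smul₀ hρ.ne', add_sub_cancel, norm_smul,
    mul_pow, Real.norm_of_nonneg hρ.le] at h1
  rw [integral_const_mul] at h1
  have h2 := Measure.setIntegral_comp_smul_of_pos
    (volume : Measure (EuclideanSpace ℝ (Fin d)))
    (fun y => ‖gradient (polyFun p) (c + y)‖ ^ 2) (Metric.ball 0 1) hρ
  rw [smul_unitBall_of_pos hρ, finrank_euclideanSpace_fin] at h2
  have h3 := (measurePreserving_add_left (volume : Measure (EuclideanSpace ℝ (Fin d))) c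
    ).setIntegral_preimage_emb (measurableEmbedding_addLeft c)
    (fun y => ‖gradient (polyFun p) y‖ ^ 2) (Metric.ball c ρ)
  have h4 : (fun y => c + y) ⁻¹' Metric.ball c ρ = Metric.ball 0 ρ := by
    ext y; simp
  rw [h4] at h3
  rw [h2, h3, smul_eq_mul] at h1
  have hpow : 0 < ρ ^ d := by positivity
  calc _ ≤ (C * (ρ ^ 2 * ((ρ ^ d)⁻¹ *
          ∫ y in Metric.ball c ρ, ‖gradient (polyFun p) y‖ ^ 2))) * ρ ^ d :=
        mul_le_mul_of_nonneg_right h1 hpow.le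
    _ = _ := by field_simp

/-! ### Exponential decay of coefficients -/

/-- Hole filling: split the expansion into indices outside `F m`, the layer `F m \ F (m + 1)` with
sum `z`, and the tail with sum `w`. Testing with `w` eliminates the first part by locality, so the
tail is controlled by the layer alone. -/
theorem sum_sq_le_pow_of_local {ι V : Type*} [Fintype ι] [DecidableEq ι] [AddCommGroup V]
    [Module ℝ V] (D : LinearMap.BilinForm ℝ V) (hD0 : ∀ u, 0 ≤ D u u)
    (hDs : ∀ u v, D u v = D v u) (B : ι → V) {C₁ κ : ℝ} (hC₁ : 0 < C₁) (hκ : 0 ≤ κ)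
    (hR : ∀ a : ι → ℝ, C₁ * ∑ i, a i ^ 2 ≤ D (∑ i, a i • B i) (∑ i, a i • B i) ∧
      D (∑ i, a i • B i) (∑ i, a i • B i) ≤ κ * C₁ * ∑ i, a i ^ 2)
    (c : ι → ℝ) (F : ℕ → Finset ι) (hanti : ∀ m, F (m + 1) ⊆ F m)
    (hloc : ∀ m, ∀ i ∉ F m, ∀ j ∈ F (m + 1), D (B i) (B j) = 0)
    (horth : ∀ m, ∀ j ∈ F (m + 1), D (∑ i, c i • B i) (B j) = 0) (m : ℕ) :
    ∑ i ∈ F m, c i ^ 2 ≤ (κ / (1 + κ)) ^ m * ∑ i, c i ^ 2 := by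
  have hRs : ∀ s : Finset ι, C₁ * ∑ i ∈ s, c i ^ 2 ≤
      D (∑ i ∈ s, c i • B i) (∑ i ∈ s, c i • B i) ∧
      D (∑ i ∈ s, c i • B i) (∑ i ∈ s, c i • B i) ≤ κ * C₁ * ∑ i ∈ s, c i ^ 2 := by
    intro s
    have h := hR fun i => if i ∈ s then c i else 0
    simpa only [ite_smul, zero_smul, Finset.sum_ite_mem, Finset.univ_inter, ite_pow,
      zero_pow two_ne_zero] using h
  induction m with
  | zero =>
    rw [pow_zero, one_mul]
    exact Finset.sum_le_sum_of_subset_of_nonneg (Finset.subset_univ _) fun i _ _ => sq_nonneg _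
  | succ m ih =>
    set w := ∑ i ∈ F (m + 1), c i • B i with hw
    set z := ∑ i ∈ F m \ F (m + 1), c i • B i with hz
    have h1 : ∑ i, c i • B i = ∑ i ∈ (F m)ᶜ, c i • B i + (z + w) := by
      rw [hz, hw, Finset.sum_sdiff (hanti m), Finset.sum_compl_add_sum]
    have h2 : D (∑ i, c i • B i) w = 0 := by
      rw [hw, map_sum]
      refine Finset.sum_eq_zero fun j hj => ?_
      rw [map_smul, horth m j hj, smul_zero]
    have h3 : D (∑ i ∈ (F m)ᶜ, c i • B i) w = 0 := by
      rw [hw, map_sum]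
      refine Finset.sum_eq_zero fun j hj => ?_
      rw [map_smul, map_sum, LinearMap.sum_apply, Finset.sum_eq_zero, smul_zero]
      intro i hi
      rw [map_smul, LinearMap.smul_apply, hloc m i (Finset.mem_compl.1 hi) j hj, smul_zero]
    rw [h1, map_add, LinearMap.add_apply, h3, zero_add, map_add, LinearMap.add_apply] at h2
    -- Here `D z w = -D w w`, so `D (z + w) (z + w) = D z z - D w w`.
    have h4 : D w w ≤ D z z := by
      have h5 : 0 ≤ D (z + w) (z + w) := hD0 _
      simp only [map_add, LinearMap.add_apply] at h5
      rw [hDs w z] at h5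
      linarith
    have h5 := (hRs (F (m + 1))).1.trans (h4.trans (hRs (F m \ F (m + 1))).2)
    have h6 := Finset.sum_sdiff (f := fun i => c i ^ 2) (hanti m)
    have h7 : ∑ i ∈ F (m + 1), c i ^ 2 ≤ κ / (1 + κ) * ∑ i ∈ F m, c i ^ 2 := by
      -- Filling the hole: add `κ` times the tail to both sides, which completes the layer to `F m`.
      rw [div_mul_eq_mul_div, le_div_iff₀ (by linarith)]
      have h8 : C₁ * ∑ i ∈ F (m + 1), c i ^ 2 ≤
          C₁ * (κ * ∑ i ∈ F m \ F (m + 1), c i ^ 2) := by linarith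
      have h9 := le_of_mul_le_mul_left h8 hC₁
      nlinarith
    have h8 : 0 ≤ κ / (1 + κ) := by positivity
    calc _ ≤ _ := h7
      _ ≤ κ / (1 + κ) * ((κ / (1 + κ)) ^ m * ∑ i, c i ^ 2) := mul_le_mul_of_nonneg_left ih h8
      _ = _ := by ring

/-- Bernoulli's inequality for `σ = 1 - (1 - θ) / N`. -/
theorem exists_root_bound {θ : ℝ} (h0 : 0 < θ) (h1 : θ < 1) {N : ℕ} (hN : 1 ≤ N) :
    ∃ σ : ℝ, 0 < σ ∧ σ < 1 ∧ θ ≤ σ ^ N := by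
  have hN' : (1 : ℝ) ≤ N := by exact_mod_cast hN
  have h2 : (1 - θ) / N ≤ 1 - θ := div_le_self (by linarith) hN'
  have h3 : 0 < (1 - θ) / N := div_pos (by linarith) (by linarith)
  refine ⟨1 + -((1 - θ) / N), by linarith, by linarith, ?_⟩
  have h4 := one_add_mul_le_pow (a := -((1 - θ) / N)) (by linarith) N
  have h5 : (1 : ℝ) + N * -((1 - θ) / N) = θ := by field_simp; ring
  rwa [h5] at h4

namespace SimplicialPartition

variable {d : ℕ} {P : SimplicialPartition d}

/-! ### Pointwise bounds by the energy -/

/-- Quasi-uniformity puts `T` inside the ball of radius `2 * β * ρ` about the centre of an inscribed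
ball of radius `ρ`, so the polynomial bound applies with `R = 2 * β`. -/
theorem exists_osc_bound_spline (d n : ℕ) (β : ℝ) (hd : 2 ≤ d) : ∃ C > 0,
    ∀ (r : ℕ) (P : SimplicialPartition d), P.QuasiUniform β →
      ∀ u, P.IsSpline r n u → ∀ T ∈ P.simplices,
        ∀ x ∈ convexHull ℝ (T : Set (EuclideanSpace ℝ (Fin d))),
        ∀ y ∈ convexHull ℝ (T : Set (EuclideanSpace ℝ (Fin d))),
          (u x - u y) ^ 2 * P.meshSize ^ (d - 2) ≤ C * P.energy u := by
  obtain ⟨C, hC, h⟩ := exists_osc_bound d n (2 * β)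
  -- The 4 comes from comparing both points with the centre; `|β|` and `+ 1` keep the constant
  -- positive for every `β`.
  refine ⟨4 * ((2 * |β|) ^ (d - 2) * C) + 1, by positivity, fun r P hP u hu T hT x hx y hy => ?_⟩
  obtain ⟨hβ, c, ρ, hρ, hball, hmesh⟩ := hP.exists_ball (by omega) hT
  have hmesh0 := meshSize_pos (by omega : 1 ≤ d) hT
  obtain ⟨p, hp, hup, -⟩ := hu.exists_polyFun hT
  have hE : 0 ≤ P.energy u := integral_nonneg fun x => sq_nonneg _
  have hcT : c ∈ convexHull ℝ (T : Set (EuclideanSpace ℝ (Fin d))) :=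
    hball (Metric.mem_closedBall_self hρ.le)
  have key : ∀ z ∈ convexHull ℝ (T : Set (EuclideanSpace ℝ (Fin d))),
      (u z - u c) ^ 2 * P.meshSize ^ (d - 2) ≤ (2 * |β|) ^ (d - 2) * C * P.energy u := by
    intro z hz
    have h1 := h p hp c ρ hρ z ((dist_le_meshSize hT hz hcT).trans hmesh)
    rw [← hup z hz, ← hup c hcT] at h1
    have h2 := setIntegral_le_energy hu hT hup Metric.isOpen_ball
      (Metric.ball_subset_closedBall.trans hball)
    have h3 : (u z - u c) ^ 2 * ρ ^ (d - 2) ≤ C * P.energy u := by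
      have h4 : ρ ^ d = ρ ^ 2 * ρ ^ (d - 2) := by rw [← pow_add]; congr 1; omega
      rw [h4] at h1
      have h5 : ρ ^ 2 * ((u z - u c) ^ 2 * ρ ^ (d - 2)) ≤ ρ ^ 2 * (C * P.energy u) := by
        calc _ = _ := by ring
          _ ≤ _ := h1
          _ ≤ C * ρ ^ 2 * P.energy u := mul_le_mul_of_nonneg_left h2 (by positivity)
          _ = _ := by ring
      exact le_of_mul_le_mul_left h5 (by positivity)
    calc (u z - u c) ^ 2 * P.meshSize ^ (d - 2)
        ≤ (u z - u c) ^ 2 * (2 * β * ρ) ^ (d - 2) := by gcongr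
      _ = (2 * β) ^ (d - 2) * ((u z - u c) ^ 2 * ρ ^ (d - 2)) := by rw [mul_pow]; ring
      _ ≤ (2 * β) ^ (d - 2) * (C * P.energy u) := by gcongr
      _ = _ := by rw [abs_of_pos hβ]; ring
  have hx' := key x hx
  have hy' := key y hy
  have h1 : (u x - u y) ^ 2 ≤ 2 * (u x - u c) ^ 2 + 2 * (u y - u c) ^ 2 := by
    nlinarith [sq_nonneg (u x - u c + (u y - u c))]
  calc _ ≤ (2 * (u x - u c) ^ 2 + 2 * (u y - u c) ^ 2) * P.meshSize ^ (d - 2) :=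
        mul_le_mul_of_nonneg_right h1 (by positivity)
    _ ≤ _ := by linarith

theorem exists_abs_sub_le_of_mem_star {u : EuclideanSpace ℝ (Fin d) → ℝ} {δ : ℝ}
    (hu : ∀ T ∈ P.simplices, ∀ x ∈ convexHull ℝ (T : Set (EuclideanSpace ℝ (Fin d))),
      ∀ y ∈ convexHull ℝ (T : Set (EuclideanSpace ℝ (Fin d))), |u x - u y| ≤ δ)
    {s : Finset (EuclideanSpace ℝ (Fin d))} {k : ℕ} {T : Finset (EuclideanSpace ℝ (Fin d))}
    (hT : T ∈ P.star s k) {y : EuclideanSpace ℝ (Fin d)}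
    (hy : y ∈ convexHull ℝ (T : Set (EuclideanSpace ℝ (Fin d)))) :
    ∃ q ∈ s, |u q - u y| ≤ k * δ := by
  induction k generalizing T y with
  | zero => exact hT.elim
  | succ k ih =>
    rcases k with _ | k
    · obtain ⟨h, q, hq, hqs⟩ := hT
      exact ⟨q, hqs, by simpa using hu T h q (subset_convexHull ℝ _ hq) y hy⟩
    · obtain ⟨h, T', hT', q, hq, hq'⟩ := hT
      obtain ⟨q', hq's, h1⟩ := ih hT' (subset_convexHull ℝ _ hq')
      have h2 := hu T h q (subset_convexHull ℝ _ hq) y hy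
      refine ⟨q', hq's, (abs_sub_le _ (u q) _).trans ?_⟩
      push_cast at h1 ⊢
      linarith

/-- A nonempty compact set in positive dimension has a frontier point. It lies on `∂Ω`, where `u`
vanishes, or inside `Ω`, where `u ≠ 0` would make `K` a neighbourhood of it. This is applied to sets
carrying the support and to level sets. -/
theorem exists_eq_zero_of_mem_nhds {r n : ℕ} (hd : 1 ≤ d) {u : EuclideanSpace ℝ (Fin d) → ℝ}
    (hu : P.IsSplineZero r n u) {K : Set (EuclideanSpace ℝ (Fin d))} (hK : IsCompact K)
    (hne : K.Nonempty) (hKP : K ⊆ P.domain)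
    (h : ∀ x ∈ K, x ∈ interior P.domain → u x ≠ 0 → K ∈ nhds x) : ∃ x ∈ K, u x = 0 := by
  have : Nonempty (Fin d) := ⟨⟨0, hd⟩⟩
  have hfr : (frontier K).Nonempty := by
    rw [nonempty_iff_ne_empty]
    intro h0
    rcases isClopen_iff.1 (isClopen_iff_frontier_eq_empty.2 h0) with h1 | h1
    · exact hne.ne_empty h1
    · exact noncompact_univ _ (h1 ▸ hK)
  obtain ⟨x, hx⟩ := hfr
  have hxK : x ∈ K := hK.isClosed.frontier_subset hx
  refine ⟨x, hxK, ?_⟩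
  by_cases hxf : x ∈ frontier P.domain
  · exact hu.2 x hxf
  have hxi : x ∈ interior P.domain := by
    by_contra h0
    exact hxf ⟨subset_closure (hKP hxK), h0⟩
  by_contra hux
  exact hx.2 (mem_interior_iff_mem_nhds.2 (h x hxK hxi hux))

theorem exists_eq_zero_of_support {r n : ℕ} (hd : 1 ≤ d) {u : EuclideanSpace ℝ (Fin d) → ℝ}
    (hu : P.IsSplineZero r n u) {K : Set (EuclideanSpace ℝ (Fin d))} (hK : IsCompact K)
    (hne : K.Nonempty) (hKP : K ⊆ P.domain) (h : ∀ x ∈ P.domain, x ∉ K → u x = 0) :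
    ∃ x ∈ K, u x = 0 := by
  refine exists_eq_zero_of_mem_nhds hd hu hK hne hKP fun x _ hxi hux => ?_
  have hcont : ContinuousAt u x := hu.1.1.continuousAt (mem_interior_iff_mem_nhds.1 hxi)
  filter_upwards [hcont.eventually_ne hux, mem_interior_iff_mem_nhds.1 hxi] with y hy hyd
  by_contra hyK
  exact hy (h y hyd hyK)

/-- Walk from a zero of `u` in `star^k(T)` to a vertex of `T` through `k` simplices, then cross `T`
itself to `v`. -/
theorem IsSplineZero.abs_le {r n k : ℕ} (hd : 1 ≤ d) {u : EuclideanSpace ℝ (Fin d) → ℝ} {δ : ℝ}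
    (hu : P.IsSplineZero r n u)
    (hδ : ∀ T ∈ P.simplices, ∀ x ∈ convexHull ℝ (T : Set (EuclideanSpace ℝ (Fin d))),
      ∀ y ∈ convexHull ℝ (T : Set (EuclideanSpace ℝ (Fin d))), |u x - u y| ≤ δ)
    {T : Finset (EuclideanSpace ℝ (Fin d))} (hT : T ∈ P.simplices) (hk : 1 ≤ k)
    (h : ∀ x ∈ P.domain, x ∉ P.starSet T k → u x = 0) {v : EuclideanSpace ℝ (Fin d)}
    (hv : v ∈ convexHull ℝ (T : Set (EuclideanSpace ℝ (Fin d)))) : |u v| ≤ (k + 1) * δ := by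
  obtain ⟨q, hq⟩ := nonempty_of_mem_simplices hT
  have hTk : T ∈ P.star T k := star_mono hk (mem_star_one hT hq hq)
  obtain ⟨x, hx, hux⟩ := exists_eq_zero_of_support hd hu isCompact_starSet
    ⟨v, mem_biUnion hTk hv⟩ starSet_subset_domain h
  obtain ⟨T', hT', hxT'⟩ := mem_iUnion₂.1 hx
  obtain ⟨q', hq', h1⟩ := exists_abs_sub_le_of_mem_star hδ hT' hxT'
  have h2 := hδ T hT v hv q' (subset_convexHull ℝ _ hq')
  rw [hux, sub_zero] at h1
  calc |u v| = |(u v - u q') + u q'| := by ring_nf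
    _ ≤ |u v - u q'| + |u q'| := abs_add_le _ _
    _ ≤ _ := by linarith

/-! ### The variational characterization -/

theorem IsSplineZero.sub_of_hat {r n : ℕ} {p : EuclideanSpace ℝ (Fin d)}
    {S G : EuclideanSpace ℝ (Fin d) → ℝ} (hS : P.IsSpline r n S) (hG : P.IsSpline r n G)
    (hS' : P.HasHatBoundaryValues p S) (hG' : P.HasHatBoundaryValues p G) :
    P.IsSplineZero r n (S - G) := by
  refine ⟨(P.splineSpace r n).sub_mem hS hG, fun x hx => ?_⟩
  have hxd := P.isCompact_domain.isClosed.frontier_subset hx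
  obtain ⟨T, hT, hxT⟩ := mem_domain_iff.1 hxd
  obtain ⟨w, hw0, hw1, rfl⟩ := Finset.mem_convexHull'.1 hxT
  have h1 := hS' T hT.1 w hw0 hw1 hx
  have h2 := hG' T hT.1 w hw0 hw1 hx
  by_cases hp : p ∈ T
  · rw [Pi.sub_apply, h1.1 hp, h2.1 hp, sub_self]
  · rw [Pi.sub_apply, h1.2 hp, h2.2 hp, sub_self]

theorem IsSplineZero.sum {r n : ℕ} {ι : Type*} {s : Finset ι}
    {B : ι → EuclideanSpace ℝ (Fin d) → ℝ} (hB : ∀ i, P.IsSplineZero r n (B i)) (c : ι → ℝ) :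
    P.IsSplineZero r n (∑ i ∈ s, c i • B i) := by
  refine ⟨(P.splineSpace r n).sum_mem fun i _ => (P.splineSpace r n).smul_mem _ (hB i).1,
    fun x hx => ?_⟩
  simp [Finset.sum_apply, (hB _).2 x hx]

/-- The Euler–Lagrange equation: `S + t • φ` is admissible for every `t`. -/
theorem IsBoundaryGBCSpline.dirichlet_eq_zero {r n : ℕ} {p : EuclideanSpace ℝ (Fin d)}
    {S φ : P.splineSpace r n} (hS : P.IsBoundaryGBCSpline r n p S)
    (hφ : ∀ x ∈ frontier P.domain, φ.1 x = 0) : P.dirichlet r n S φ = 0 := by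
  set a := P.dirichlet r n φ φ with ha
  set b := P.dirichlet r n S φ with hb
  have ha0 : 0 ≤ a := dirichlet_self_nonneg φ
  have key : ∀ t : ℝ, 0 ≤ 2 * t * b + t ^ 2 * a := by
    intro t
    have h1 := hS.2.2 (S + t • φ : P.splineSpace r n) (S + t • φ : P.splineSpace r n).2 (by
      intro s hs w hw0 hw1 hx
      have h2 := hS.2.1 s hs w hw0 hw1 hx
      simpa [hφ _ hx] using h2)
    rw [← dirichlet_self, ← dirichlet_self] at h1
    simp only [map_add, map_smul, LinearMap.add_apply, LinearMap.smul_apply, smul_eq_mul,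
      dirichlet_comm φ S] at h1
    rw [← ha, ← hb] at h1
    linarith
  -- The denominator `a + 1` instead of `a` also covers test functions of zero energy.
  have h1 := key (-(b / (a + 1)))
  have h2 : 2 * -(b / (a + 1)) * b + (-(b / (a + 1))) ^ 2 * a =
      -(b ^ 2 * (a + 2) / (a + 1) ^ 2) := by field_simp; ring
  rw [h2] at h1
  by_contra hb0
  have : 0 < b ^ 2 * (a + 2) / (a + 1) ^ 2 := by positivity
  linarith

theorem dirichlet_congr_left {r n : ℕ} {u u' v : P.splineSpace r n}
    (h : ∀ x ∈ P.domain, u.1 x = u'.1 x) : P.dirichlet r n u v = P.dirichlet r n u' v := by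
  rw [← sub_eq_zero, ← LinearMap.sub_apply, ← map_sub]
  refine dirichlet_eq_zero fun T hT => Or.inl fun x hx => ?_
  simp [h x (hull_subset_domain hT hx)]

/-- Recasts the basis in the bilinear setting; `max κ 1` makes the ratio positive for every real
`κ`. -/
theorem HasLocalRieszBasis.exists_basis {r n l : ℕ} {κ : ℝ} (h : P.HasLocalRieszBasis r n l κ) :
    ∃ (m : ℕ) (B : Fin m → P.splineSpace r n)
    (τ : Fin m → Finset (EuclideanSpace ℝ (Fin d))) (C₁ : ℝ),
    0 < C₁ ∧ (∀ ξ, P.IsSplineZero r n (B ξ)) ∧ (∀ ξ, τ ξ ∈ P.simplices) ∧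
    (∀ ξ, ∀ x ∈ P.domain, x ∉ P.starSet (τ ξ) l → (B ξ).1 x = 0) ∧
    (∀ u, P.IsSplineZero r n u → ∃ c : Fin m → ℝ, ∀ x ∈ P.domain,
      u x = (∑ ξ, c ξ • B ξ : P.splineSpace r n).1 x) ∧
    ∀ c : Fin m → ℝ,
      C₁ * ∑ ξ, c ξ ^ 2 ≤ P.dirichlet r n (∑ ξ, c ξ • B ξ) (∑ ξ, c ξ • B ξ) ∧
      P.dirichlet r n (∑ ξ, c ξ • B ξ) (∑ ξ, c ξ • B ξ) ≤ max κ 1 * C₁ * ∑ ξ, c ξ ^ 2 := by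
  obtain ⟨m, B, τ, C₁, C₂, hC₁, hC₂, hB, hτ, hspan, hR⟩ := h
  have hcoe : ∀ c : Fin m → ℝ, ((∑ ξ, c ξ • (⟨B ξ, (hB ξ).1⟩ : P.splineSpace r n) :
      P.splineSpace r n) : EuclideanSpace ℝ (Fin d) → ℝ) = fun x => ∑ ξ, c ξ * B ξ x := by
    intro c
    ext x
    simp [Finset.sum_apply]
  refine ⟨m, fun ξ => ⟨B ξ, (hB ξ).1⟩, τ, C₁, hC₁, hB, fun ξ => (hτ ξ).1, fun ξ => (hτ ξ).2,
    fun u hu => ?_, fun c => ?_⟩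
  · obtain ⟨c, hc⟩ := hspan u hu
    exact ⟨c, fun x hx => by rw [hcoe, hc x hx]⟩
  · rw [dirichlet_self, hcoe]
    refine ⟨(hR c).1, (hR c).2.trans ?_⟩
    have h1 : 0 ≤ ∑ ξ, c ξ ^ 2 := Finset.sum_nonneg fun i _ => sq_nonneg _
    refine mul_le_mul_of_nonneg_right (hC₂.trans ?_) h1
    exact mul_le_mul_of_nonneg_right (le_max_left _ _) hC₁.le

/-- Energy bound for the part of a boundary GBC spline that is made of the basis functions which
are nonzero at a point far from the boundary vertex. -/
theorem exists_near_part {r n l : ℕ} {κ : ℝ} (h : P.HasLocalRieszBasis r n l κ)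
    {p : EuclideanSpace ℝ (Fin d)} {S G : P.splineSpace r n}
    (hS : P.IsBoundaryGBCSpline r n p S) (hG : P.HasHatBoundaryValues p G)
    (hGl : ∀ x ∈ P.domain, x ∉ P.starSet {p} l → G.1 x = 0)
    {v : EuclideanSpace ℝ (Fin d)} {T : Finset (EuclideanSpace ℝ (Fin d))} (hT : T ∈ P.simplices)
    (hv : v ∈ convexHull ℝ (T : Set (EuclideanSpace ℝ (Fin d)))) {m : ℕ}
    (hm : T ∉ P.star {p} ((2 * l + 2) * m + (l + 1)) ∨ m = 0) :
    ∃ u, P.IsSplineZero r n u ∧ S.1 v = G.1 v + u v ∧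
      (∀ x ∈ P.domain, x ∉ P.starSet T (2 * l + 1) → u x = 0) ∧
      P.energy u ≤ max κ 1 * (max κ 1 / (1 + max κ 1)) ^ m * P.energy G := by
  classical
  obtain ⟨N, B, τ, C₁, hC₁, hB, hτ, hBl, hspan, hR⟩ := h.exists_basis
  set κ' := max κ 1 with hκ'
  have hκ1 : 1 ≤ κ' := le_max_right _ _
  set D := P.dirichlet r n with hD
  obtain ⟨c, hc⟩ := hspan _ (IsSplineZero.sub_of_hat S.2 G.2 hS.2.1 hG)
  set W : P.splineSpace r n := ∑ ξ, c ξ • B ξ with hW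
  have hWD : ∀ φ : P.splineSpace r n, (∀ x ∈ frontier P.domain, φ.1 x = 0) →
      D W φ = - D G φ := by
    intro φ hφ
    have h1 : D W φ = D (S - G) φ :=
      (dirichlet_congr_left fun x hx => by rw [← hc x hx]; simp).symm
    rw [h1, map_sub, LinearMap.sub_apply, hS.dirichlet_eq_zero hφ, zero_sub]
  have hsum0 : ∀ s : Finset (Fin N), P.IsSplineZero r n
      (∑ ξ ∈ s, c ξ • B ξ : P.splineSpace r n) := by
    intro s
    have := IsSplineZero.sum (s := s) hB c
    simpa using this
  -- Since `D W W = -D G W`, nonnegativity of `D (W + G) (W + G)` is exactly this bound.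
  have hWE : D W W ≤ D G G := by
    have h1 := hWD W (hsum0 _).2
    have h2 : 0 ≤ D (W + G) (W + G) := dirichlet_self_nonneg _
    have h3 : D G W = D W G := dirichlet_comm _ _
    simp only [map_add, LinearMap.add_apply] at h2
    linarith
  -- The step `2 * l + 2` is the interaction range of two basis functions. At `m = 0` the star is
  -- empty by definition, so `F 0` contains all indices.
  set F : ℕ → Finset (Fin N) := fun m => {ξ | τ ξ ∉ P.star {p} ((2 * l + 2) * m)} with hF
  have hmemF : ∀ m ξ, ξ ∈ F m ↔ τ ξ ∉ P.star {p} ((2 * l + 2) * m) := by simp [hF]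
  have hdecay := sum_sq_le_pow_of_local D dirichlet_self_nonneg dirichlet_comm B hC₁
    (by linarith) hR c F
    (fun m ξ hξ => by
      rw [hmemF] at hξ ⊢
      exact fun h => hξ (star_mono (by rw [mul_add]; omega) h))
    (fun m i hi j hj => by
      rw [hmemF] at hi hj
      refine dirichlet_eq_zero_of_star (hBl i) (hBl j) (hτ j) fun h => hj ?_
      have := star_trans (not_not.1 hi) h
      rwa [show (2 * l + 2) * m + (l + l + 2) = (2 * l + 2) * (m + 1) by ring] at this)
    (fun m j hj => by
      rw [hmemF] at hj
      rw [hWD _ (hB j).2, dirichlet_eq_zero_of_star hGl (hBl j) (hτ j) fun h => hj ?_, neg_zero]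
      exact star_mono (by rw [mul_add]; omega) h)
    m
  set Ξ : Finset (Fin N) := {ξ | (B ξ).1 v ≠ 0} with hΞ
  have hΞstar : ∀ ξ ∈ Ξ, τ ξ ∈ P.star T (l + 1) := by
    intro ξ hξ
    have h1 : v ∈ P.starSet (τ ξ) l := by
      by_contra h
      exact (Finset.mem_filter.1 hξ).2 (hBl ξ v (hull_subset_domain hT hv) h)
    exact star_symm (hτ ξ) (mem_star_of_mem_starSet hT hv h1)
  -- A simplex `τ ξ` within `(2 * l + 2) * m` rings of `p` would bring `T` within `l + 1` further
  -- rings, against `hm`; for `m = 0` there is nothing to exclude.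
  have hΞF : Ξ ⊆ F m := by
    intro ξ hξ
    rw [hmemF]
    intro h
    rcases hm with hm | rfl
    · exact hm (star_trans h (star_symm hT (hΞstar ξ hξ)))
    · exact h
  refine ⟨(∑ ξ ∈ Ξ, c ξ • B ξ : P.splineSpace r n), hsum0 Ξ, ?_, ?_, ?_⟩
  · have h1 : W.1 v = (∑ ξ ∈ Ξ, c ξ • B ξ : P.splineSpace r n).1 v := by
      simp only [hW, Submodule.coe_sum, Submodule.coe_smul, Finset.sum_apply, Pi.smul_apply]
      refine (Finset.sum_subset (Finset.subset_univ Ξ) fun ξ _ hξ => ?_).symm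
      have : (B ξ).1 v = 0 := by simpa [hΞ] using hξ
      rw [this, smul_zero]
    rw [← h1, ← hc v (hull_subset_domain hT hv)]
    simp
  · intro x hx hxs
    simp only [Submodule.coe_sum, Submodule.coe_smul, Finset.sum_apply, Pi.smul_apply]
    refine Finset.sum_eq_zero fun ξ hξ => ?_
    rw [hBl ξ x hx, smul_zero]
    intro hxτ
    obtain ⟨T', hT', hxT'⟩ := mem_iUnion₂.1 hxτ
    refine hxs (mem_biUnion ?_ hxT')
    have := star_trans (hΞstar ξ hξ) hT'
    rwa [show l + 1 + l = 2 * l + 1 by ring] at this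
  · rw [← dirichlet_self, ← dirichlet_self]
    have h1 := (hR fun ξ => if ξ ∈ Ξ then c ξ else 0).2
    simp only [ite_smul, zero_smul, Finset.sum_ite_mem, Finset.univ_inter, ite_pow,
      zero_pow two_ne_zero] at h1
    have h2 : ∑ ξ ∈ Ξ, c ξ ^ 2 ≤ ∑ ξ ∈ F m, c ξ ^ 2 :=
      Finset.sum_le_sum_of_subset_of_nonneg hΞF fun i _ _ => sq_nonneg _
    have h3 := (hR c).1.trans hWE
    have h4 : 0 ≤ κ' / (1 + κ') := by positivity
    calc _ ≤ _ := h1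
      _ ≤ κ' * C₁ * ((κ' / (1 + κ')) ^ m * ∑ i, c i ^ 2) :=
        mul_le_mul_of_nonneg_left (h2.trans hdecay) (by positivity)
      _ = κ' * (κ' / (1 + κ')) ^ m * (C₁ * ∑ i, c i ^ 2) := by ring
      _ ≤ _ := mul_le_mul_of_nonneg_left h3 (by positivity)

/-! ### Pointwise exponential decay, given a local lift -/

theorem HasHatBoundaryValues.apply_self {p : EuclideanSpace ℝ (Fin d)}
    {u : EuclideanSpace ℝ (Fin d) → ℝ} (hu : P.HasHatBoundaryValues p u)
    (hp : p ∈ P.complex.vertices) (hpf : p ∈ frontier P.domain) : u p = 1 := by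
  have h := hu {p} hp (fun _ => 1) (by simp) (by simp) (by simpa using hpf)
  simpa using h.1 (by simp)

theorem exists_decay_of_lift (κ : ℝ) (l : ℕ) : ∃ σ : ℝ, 0 < σ ∧ σ < 1 ∧
    ∀ (d n : ℕ) (β A : ℝ), 2 ≤ d → ∃ K : ℝ, 0 < K ∧
      ∀ (r : ℕ) (P : SimplicialPartition d), P.QuasiUniform β → P.HasLocalRieszBasis r n l κ →
        ∀ p ∈ P.complex.vertices, p ∈ frontier P.domain → P.HasLocalLift r n l A p →
          ∀ S : EuclideanSpace ℝ (Fin d) → ℝ, P.IsBoundaryGBCSpline r n p S →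
            ∀ v, ∀ T ∈ P.simplices, v ∈ convexHull ℝ (T : Set (EuclideanSpace ℝ (Fin d))) →
            ∀ k : ℕ, 1 ≤ k → Disjoint (P.starSet T k) (P.starSet {p} 1) →
              |S v| ≤ K * σ ^ k := by
  have hκ1 : 1 ≤ max κ 1 := le_max_right _ _
  have hθ0 : 0 < max κ 1 / (1 + max κ 1) := by positivity
  have hθ1 : max κ 1 / (1 + max κ 1) < 1 := (div_lt_one (by positivity)).2 (by linarith)
  -- One layer is `2 * l + 2` rings wide; the extra factor 2 is there because the energy decays like
  -- the square of the point values.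
  obtain ⟨σ, hσ0, hσ1, hσ⟩ := exists_root_bound hθ0 hθ1 (N := (2 * l + 2) * 2) (by omega)
  refine ⟨σ, hσ0, hσ1, fun d n β A hd => ?_⟩
  obtain ⟨C, hC, hosc⟩ := exists_osc_bound_spline d n β hd
  set M₀ := √(C * |A|) with hM₀
  set M₁ := √(C * (max κ 1 * |A|)) with hM₁
  -- The terms bound `|G v|` and the near part `u`. The division by `σ ^ (3 * l + 2)` absorbs the
  -- rings lost to the support of `G`, the star of `T` and rounding to whole layers.
  refine ⟨(1 + l * M₀ + (2 * l + 2) * M₁) / σ ^ (3 * l + 2), by positivity, ?_⟩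
  rintro r P hP hbasis p hp hpf ⟨G, hG, hGb, hGl, hGE⟩ S hS v T hT hv k hk hdisj
  have hmesh := meshSize_pos (by omega : 1 ≤ d) hT
  have hpow : 0 < P.meshSize ^ (d - 2) := by positivity
  have hGE' : P.energy G ≤ |A| * P.meshSize ^ (d - 2) :=
    hGE.trans (mul_le_mul_of_nonneg_right (le_abs_self A) hpow.le)
  have hosc' : ∀ (u : EuclideanSpace ℝ (Fin d) → ℝ) (a : ℝ), P.IsSpline r n u →
      P.energy u ≤ a * P.meshSize ^ (d - 2) →
      ∀ T ∈ P.simplices, ∀ x ∈ convexHull ℝ (T : Set (EuclideanSpace ℝ (Fin d))),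
      ∀ y ∈ convexHull ℝ (T : Set (EuclideanSpace ℝ (Fin d))), |u x - u y| ≤ √(C * a) := by
    intro u a hu hE T hT x hx y hy
    refine Real.abs_le_sqrt (le_of_mul_le_mul_right ((hosc r P hP u hu T hT x hx y hy).trans ?_)
      hpow)
    rw [mul_assoc]
    exact mul_le_mul_of_nonneg_left hE hC.le
  have hnot := notMem_star_of_disjoint hk hdisj
  -- On its support `G` is compared with `G p = 1` along at most `l` simplices. For `l ≤ k` the
  -- point `v` is outside that support, since `T` is not in `star^{k+1}(p)`.
  have hGv : |G v| ≤ 1 + l * M₀ ∧ (l ≤ k → G v = 0) := by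
    by_cases hvs : v ∈ P.starSet {p} l
    · constructor
      · obtain ⟨T', hT', hvT'⟩ := mem_iUnion₂.1 hvs
        obtain ⟨q, hq, h1⟩ := exists_abs_sub_le_of_mem_star (hosc' G |A| hG hGE') hT' hvT'
        rw [Finset.mem_singleton.1 hq, hGb.apply_self hp hpf] at h1
        have h2 := abs_sub_abs_le_abs_sub (G v) 1
        rw [abs_one, abs_sub_comm] at h2
        linarith
      · intro hlk
        exact (hnot (star_mono (by omega) (mem_star_of_mem_starSet hT hv hvs))).elim
    · rw [hGl v (hull_subset_domain hT hv) hvs, abs_zero]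
      exact ⟨by positivity, fun _ => rfl⟩
  -- The largest number of layers with `(2 * l + 2) * m + (l + 1) ≤ k + 1` if `l ≤ k`; truncated
  -- subtraction gives `m = 0` otherwise.
  set m := (k - l) / (2 * l + 2) with hm
  have hm1 : (2 * l + 2) * m ≤ k - l := Nat.mul_div_le _ _
  have hm2 : k ≤ (2 * l + 2) * m + (3 * l + 2) := by
    have := Nat.lt_mul_div_succ (k - l) (show 0 < 2 * l + 2 by omega)
    rw [mul_add, ← hm] at this
    omega
  obtain ⟨u, hu, hSu, hus, huE⟩ := exists_near_part hbasis (S := ⟨S, hS.1⟩) (G := ⟨G, hG⟩) hS hGb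
    hGl hT hv (m := m) (by
      rcases le_or_gt l k with hlk | hlk
      · exact Or.inl fun h => hnot (star_mono (by omega) h)
      · exact Or.inr (by rw [hm, Nat.sub_eq_zero_of_le hlk.le, Nat.zero_div]))
  have hu1 : |u v| ≤ (2 * l + 2) * M₁ * σ ^ ((2 * l + 2) * m) := by
    have h1 : P.energy u ≤ (max κ 1 * |A| * (σ ^ ((2 * l + 2) * m)) ^ 2) *
        P.meshSize ^ (d - 2) := by
      have h2 : (max κ 1 / (1 + max κ 1)) ^ m ≤ (σ ^ ((2 * l + 2) * m)) ^ 2 := by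
        calc _ ≤ (σ ^ ((2 * l + 2) * 2)) ^ m := pow_le_pow_left₀ hθ0.le hσ m
          _ = _ := by rw [← pow_mul, ← pow_mul]; congr 1; ring
      calc P.energy u ≤ _ := huE
        _ ≤ max κ 1 * (σ ^ ((2 * l + 2) * m)) ^ 2 * (|A| * P.meshSize ^ (d - 2)) :=
          mul_le_mul (mul_le_mul_of_nonneg_left h2 (by positivity)) hGE'
            (integral_nonneg fun x => sq_nonneg _) (by positivity)
        _ = _ := by ring
    have h2 := hu.abs_le (k := 2 * l + 1) (by omega) (hosc' u _ hu.1 h1) hT (by omega) hus hv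
    rw [← mul_assoc, Real.sqrt_mul' _ (sq_nonneg _), Real.sqrt_sq (by positivity)] at h2
    calc _ ≤ _ := h2
      _ = _ := by push_cast; ring
  have hσk : σ ^ ((2 * l + 2) * m) * σ ^ (3 * l + 2) ≤ σ ^ k := by
    rw [← pow_add]
    exact pow_le_pow_of_le_one hσ0.le hσ1.le hm2
  have hGv' : |G v| * σ ^ (3 * l + 2) ≤ (1 + l * M₀) * σ ^ k := by
    rcases le_or_gt l k with hlk | hlk
    · rw [hGv.2 hlk, abs_zero, zero_mul]
      positivity
    · exact mul_le_mul hGv.1 (pow_le_pow_of_le_one hσ0.le hσ1.le (by omega)) (by positivity)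
        (by positivity)
  have hSv : S v = G v + u v := hSu
  rw [div_mul_eq_mul_div, le_div_iff₀ (by positivity), hSv]
  calc |G v + u v| * σ ^ (3 * l + 2) ≤ (|G v| + |u v|) * σ ^ (3 * l + 2) := by
        gcongr; exact abs_add_le _ _
    _ = |G v| * σ ^ (3 * l + 2) + |u v| * σ ^ (3 * l + 2) := by ring
    _ ≤ (1 + l * M₀) * σ ^ k + (2 * l + 2) * M₁ * (σ ^ ((2 * l + 2) * m) * σ ^ (3 * l + 2)) := by
        refine add_le_add hGv' ?_
        rw [← mul_assoc]
        gcongr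
    _ ≤ (1 + l * M₀) * σ ^ k + (2 * l + 2) * M₁ * σ ^ k := by gcongr
    _ = _ := by ring

end SimplicialPartition

/-! ### Affine functions -/

theorem exists_affine_eq_inner {d : ℕ} (f : EuclideanSpace ℝ (Fin d) →ᵃ[ℝ] ℝ) :
    ∃ g, ∀ x, f x = inner ℝ g x + f 0 := by
  refine ⟨(InnerProductSpace.toDual ℝ (EuclideanSpace ℝ (Fin d))).symm
    (LinearMap.toContinuousLinearMap f.linear), fun x => ?_⟩
  rw [InnerProductSpace.toDual_symm_apply, LinearMap.coe_toContinuousLinearMap']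
  simpa using congrFun f.decomp x

theorem exists_polyFun_eq_affine {d : ℕ} (f : EuclideanSpace ℝ (Fin d) →ᵃ[ℝ] ℝ) :
    ∃ p : MvPolynomial (Fin d) ℝ, p.totalDegree ≤ 1 ∧ ∀ x, f x = polyFun p x := by
  obtain ⟨g, hg⟩ := exists_affine_eq_inner f
  refine ⟨∑ i, MvPolynomial.C (g i) * MvPolynomial.X i + MvPolynomial.C (f 0), ?_, fun x => ?_⟩
  · refine (MvPolynomial.totalDegree_add _ _).trans (max_le ?_ (by simp))
    refine MvPolynomial.totalDegree_finsetSum_le fun i _ => ?_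
    refine (MvPolynomial.totalDegree_mul _ _).trans ?_
    simp
  · rw [hg x, PiLp.inner_apply]
    simp [polyFun, mul_comm]

/-- From the centre to the boundary point in gradient direction `f` grows by `ρ` times the gradient
norm, and this growth is at most 1. -/
theorem norm_gradient_affine_le {d : ℕ} (f : EuclideanSpace ℝ (Fin d) →ᵃ[ℝ] ℝ)
    {c : EuclideanSpace ℝ (Fin d)} {ρ : ℝ} (hρ : 0 < ρ)
    (h : ∀ x ∈ Metric.closedBall c ρ, 0 ≤ f x ∧ f x ≤ 1) (x : EuclideanSpace ℝ (Fin d)) :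
    ‖gradient f x‖ ≤ ρ⁻¹ := by
  obtain ⟨g, hg⟩ := exists_affine_eq_inner f
  have h1 : HasGradientAt f g x := by
    rw [hasGradientAt_iff_hasFDerivAt]
    have h2 : HasFDerivAt (fun y => InnerProductSpace.toDual ℝ (EuclideanSpace ℝ (Fin d)) g y + f 0)
        (InnerProductSpace.toDual ℝ (EuclideanSpace ℝ (Fin d)) g) x :=
      (ContinuousLinearMap.hasFDerivAt _).add_const _
    exact h2.congr_of_eventuallyEq (.of_forall fun y => by
      simp only [hg y, InnerProductSpace.toDual_apply_apply])
  rw [h1.gradient]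
  by_cases hg0 : g = 0
  · rw [hg0, norm_zero]
    positivity
  have hg1 : 0 < ‖g‖ := norm_pos_iff.2 hg0
  have h2 := h (c + (ρ * ‖g‖⁻¹) • g) (by
    rw [Metric.mem_closedBall, dist_self_add_left, norm_smul, Real.norm_of_nonneg (by positivity),
      mul_assoc, inv_mul_cancel₀ hg1.ne', mul_one])
  have h3 := h c (Metric.mem_closedBall_self hρ.le)
  rw [hg, inner_add_right, inner_smul_right, real_inner_self_eq_norm_sq] at h2
  rw [hg c] at h3
  have h4 : ρ * ‖g‖⁻¹ * ‖g‖ ^ 2 = ρ * ‖g‖ := by field_simp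
  rw [← one_div, le_div_iff₀ hρ]
  linarith

theorem affine_apply_combination {d : ℕ} (f : EuclideanSpace ℝ (Fin d) →ᵃ[ℝ] ℝ)
    (s : Finset (EuclideanSpace ℝ (Fin d))) (w : EuclideanSpace ℝ (Fin d) → ℝ)
    (hw : ∑ q ∈ s, w q = 1) : f (∑ q ∈ s, w q • q) = ∑ q ∈ s, w q * f q := by
  obtain ⟨g, hg⟩ := exists_affine_eq_inner f
  have h1 : ∀ q, w q * f q = inner ℝ g (w q • q) + w q * f 0 := fun q => by
    rw [hg q, inner_smul_right, mul_add]
  rw [hg, Finset.sum_congr rfl fun q _ => h1 q, Finset.sum_add_distrib, ← inner_sum,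
    ← Finset.sum_mul, hw, one_mul]

namespace SimplicialPartition

variable {d : ℕ} {P : SimplicialPartition d}

/-! ### Barycentric coordinates -/

/-- The vertices of a simplex of the partition as an affine basis. -/
def simplexBasis {T : Finset (EuclideanSpace ℝ (Fin d))} (hT : T ∈ P.simplices) :
    AffineBasis T ℝ (EuclideanSpace ℝ (Fin d)) where
  toFun := (↑)
  ind' := P.complex.indep hT.1
  tot' := by
    rw [(P.complex.indep hT.1).affineSpan_eq_top_iff_card_eq_finrank_add_one]
    simp [hT.2]

theorem simplexBasis_apply {T : Finset (EuclideanSpace ℝ (Fin d))} (hT : T ∈ P.simplices)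
    (q : T) : simplexBasis hT q = q := rfl

open Classical in
variable (P) in
/-- The barycentric coordinate of the simplex `T` for the vertex `v`, zero if `v` is no vertex
of `T`. -/
def bary (T : Finset (EuclideanSpace ℝ (Fin d))) (v : EuclideanSpace ℝ (Fin d)) :
    EuclideanSpace ℝ (Fin d) →ᵃ[ℝ] ℝ :=
  if h : T ∈ P.simplices ∧ v ∈ T then (simplexBasis h.1).coord ⟨v, h.2⟩ else 0

theorem bary_of_mem {T : Finset (EuclideanSpace ℝ (Fin d))} (hT : T ∈ P.simplices)
    {v : EuclideanSpace ℝ (Fin d)} (hv : v ∈ T) :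
    P.bary T v = (simplexBasis hT).coord ⟨v, hv⟩ := dif_pos ⟨hT, hv⟩

theorem bary_of_notMem {T : Finset (EuclideanSpace ℝ (Fin d))}
    {v : EuclideanSpace ℝ (Fin d)} (hv : v ∉ T) : P.bary T v = 0 := dif_neg fun h => hv h.2

theorem sum_bary {T : Finset (EuclideanSpace ℝ (Fin d))} (hT : T ∈ P.simplices)
    (x : EuclideanSpace ℝ (Fin d)) : ∑ v ∈ T, P.bary T v x = 1 := by
  rw [← Finset.sum_coe_sort, ← (simplexBasis hT).sum_coord_apply_eq_one x]
  exact Finset.sum_congr rfl fun v _ => by rw [bary_of_mem hT v.2]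

theorem sum_bary_smul {T : Finset (EuclideanSpace ℝ (Fin d))} (hT : T ∈ P.simplices)
    (x : EuclideanSpace ℝ (Fin d)) : ∑ v ∈ T, P.bary T v x • v = x := by
  rw [← Finset.sum_coe_sort T fun v => P.bary T v x • v]
  conv_rhs => rw [← (simplexBasis hT).linear_combination_coord_eq_self x]
  exact Finset.sum_congr rfl fun v _ => by rw [bary_of_mem hT v.2]; rfl

open Classical in
theorem bary_vertex {T : Finset (EuclideanSpace ℝ (Fin d))} (hT : T ∈ P.simplices)
    (v : EuclideanSpace ℝ (Fin d)) {q : EuclideanSpace ℝ (Fin d)} (hq : q ∈ T) :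
    P.bary T v q = if v = q then 1 else 0 := by
  by_cases hv : v ∈ T
  · have h := (simplexBasis hT).coord_apply ⟨v, hv⟩ ⟨q, hq⟩
    rw [simplexBasis_apply] at h
    simpa [bary_of_mem hT hv] using h
  · rw [bary_of_notMem hv, if_neg (by rintro rfl; exact hv hq)]
    rfl

open Classical in
theorem bary_combination {T : Finset (EuclideanSpace ℝ (Fin d))} (hT : T ∈ P.simplices)
    {s : Finset (EuclideanSpace ℝ (Fin d))} (hs : s ⊆ T) {w : EuclideanSpace ℝ (Fin d) → ℝ}
    (hw : ∑ q ∈ s, w q = 1) (v : EuclideanSpace ℝ (Fin d)) :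
    P.bary T v (∑ q ∈ s, w q • q) = if v ∈ s then w v else 0 := by
  rw [affine_apply_combination _ _ _ hw]
  rw [Finset.sum_congr rfl fun q hq => by rw [bary_vertex hT v (hs hq)]]
  simp

theorem mem_hull_iff {T : Finset (EuclideanSpace ℝ (Fin d))} (hT : T ∈ P.simplices)
    {x : EuclideanSpace ℝ (Fin d)} :
    x ∈ convexHull ℝ (T : Set (EuclideanSpace ℝ (Fin d))) ↔ ∀ v, 0 ≤ P.bary T v x := by
  constructor
  · intro hx v
    obtain ⟨w, hw0, hw1, rfl⟩ := Finset.mem_convexHull'.1 hx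
    rw [bary_combination hT subset_rfl hw1]
    split_ifs with hv
    exacts [hw0 v hv, le_rfl]
  · intro h
    exact Finset.mem_convexHull'.2 ⟨fun v => P.bary T v x, fun v _ => h v, sum_bary hT x,
      sum_bary_smul hT x⟩

theorem bary_le_one {T : Finset (EuclideanSpace ℝ (Fin d))} (hT : T ∈ P.simplices)
    {x : EuclideanSpace ℝ (Fin d)} (hx : x ∈ convexHull ℝ (T : Set (EuclideanSpace ℝ (Fin d))))
    (v : EuclideanSpace ℝ (Fin d)) : P.bary T v x ≤ 1 := by
  by_cases hv : v ∈ T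
  · rw [← sum_bary hT x]
    exact Finset.single_le_sum (f := fun v => P.bary T v x)
      (fun q _ => (mem_hull_iff hT).1 hx q) hv
  · rw [bary_of_notMem hv]
    exact zero_le_one

/-- By the face-to-face property `x` is a convex combination of common vertices, and both
coordinates read off the same weights. This makes `hat` independent of the chosen simplex. -/
theorem bary_eq_bary {T T' : Finset (EuclideanSpace ℝ (Fin d))} (hT : T ∈ P.simplices)
    (hT' : T' ∈ P.simplices) {x : EuclideanSpace ℝ (Fin d)}
    (hx : x ∈ convexHull ℝ (T : Set (EuclideanSpace ℝ (Fin d))))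
    (hx' : x ∈ convexHull ℝ (T' : Set (EuclideanSpace ℝ (Fin d))))
    (v : EuclideanSpace ℝ (Fin d)) : P.bary T v x = P.bary T' v x := by
  classical
  have h := P.complex.inter_subset_convexHull hT.1 hT'.1 ⟨hx, hx'⟩
  rw [← Finset.coe_inter] at h
  obtain ⟨w, -, hw1, rfl⟩ := Finset.mem_convexHull'.1 h
  rw [bary_combination hT Finset.inter_subset_left hw1,
    bary_combination hT' Finset.inter_subset_right hw1]

/-! ### Hat functions and the local lift for continuous splines -/

open Classical in
variable (P) in
/-- The hat function of `v`: continuous, piecewise linear, `1` at `v` and `0` at the other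
vertices. -/
def hat (v x : EuclideanSpace ℝ (Fin d)) : ℝ :=
  if h : ∃ T ∈ P.simplices, x ∈ convexHull ℝ (T : Set (EuclideanSpace ℝ (Fin d)))
  then P.bary h.choose v x else 0

theorem hat_eq_bary {T : Finset (EuclideanSpace ℝ (Fin d))} (hT : T ∈ P.simplices)
    {x : EuclideanSpace ℝ (Fin d)} (hx : x ∈ convexHull ℝ (T : Set (EuclideanSpace ℝ (Fin d))))
    (v : EuclideanSpace ℝ (Fin d)) : P.hat v x = P.bary T v x := by
  have h : ∃ T ∈ P.simplices, x ∈ convexHull ℝ (T : Set (EuclideanSpace ℝ (Fin d))) := ⟨T, hT, hx⟩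
  rw [hat, dif_pos h]
  exact bary_eq_bary h.choose_spec.1 hT h.choose_spec.2 hx v

/-- Continuity is automatic: the simplices form a finite closed cover, and one function `u` agrees
with a polynomial on each of them. -/
theorem isSpline_zero_iff {n : ℕ} {u : EuclideanSpace ℝ (Fin d) → ℝ} : P.IsSpline 0 n u ↔
    ∀ T ∈ P.simplices, ∃ p : MvPolynomial (Fin d) ℝ, p.totalDegree ≤ n ∧
      ∀ x ∈ convexHull ℝ (T : Set (EuclideanSpace ℝ (Fin d))), u x = polyFun p x := by
  refine ⟨fun h => h.2.2, fun h => ?_⟩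
  have hc : ContinuousOn u P.domain := by
    have := P.simplices_finite.to_subtype
    rw [domain_eq, biUnion_eq_iUnion]
    refine LocallyFinite.continuousOn_iUnion (locallyFinite_of_finite _)
      (fun T => (isCompact_hull _).isClosed) fun T => ?_
    obtain ⟨p, -, hp⟩ := h T T.2
    exact (continuous_polyFun p).continuousOn.congr hp
  exact ⟨hc, by rw [Nat.cast_zero]; exact contDiffOn_zero.2 (hc.mono interior_subset), h⟩

theorem isSpline_hat {n : ℕ} (hn : 1 ≤ n) (v : EuclideanSpace ℝ (Fin d)) :
    P.IsSpline 0 n (P.hat v) := by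
  rw [isSpline_zero_iff]
  intro T hT
  obtain ⟨p, hp, h⟩ := exists_polyFun_eq_affine (P.bary T v)
  exact ⟨p, hp.trans hn, fun x hx => by rw [hat_eq_bary hT hx, h]⟩

open Classical in
theorem hat_combination {s : Finset (EuclideanSpace ℝ (Fin d))} (hs : s ∈ P.complex.faces)
    {w : EuclideanSpace ℝ (Fin d) → ℝ} (hw0 : ∀ q ∈ s, 0 ≤ w q) (hw1 : ∑ q ∈ s, w q = 1)
    (v : EuclideanSpace ℝ (Fin d)) :
    P.hat v (∑ q ∈ s, w q • q) = if v ∈ s then w v else 0 := by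
  obtain ⟨T, hT, hsT, hc⟩ := P.pure s hs
  rw [hat_eq_bary (T := T) ⟨hT, hc⟩, bary_combination ⟨hT, hc⟩ hsT hw1]
  exact convexHull_mono (by exact_mod_cast hsT) (Finset.mem_convexHull'.2 ⟨w, hw0, hw1, rfl⟩)

theorem hat_eq_zero {v x : EuclideanSpace ℝ (Fin d)} (hx : x ∈ P.domain)
    (h : x ∉ P.starSet {v} 1) : P.hat v x = 0 := by
  obtain ⟨T, hT, hxT⟩ := mem_domain_iff.1 hx
  rw [hat_eq_bary hT hxT, bary_of_notMem]
  · rfl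
  · intro hv
    exact h (mem_biUnion (mem_star_one hT hv (Finset.mem_singleton_self v)) hxT)

theorem starSet_mono {s : Finset (EuclideanSpace ℝ (Fin d))} {j k : ℕ} (h : j ≤ k) :
    P.starSet s j ⊆ P.starSet s k := biUnion_subset_biUnion_left (star_mono h)

/-- The gradient is at most `2 * β / |△|` and vanishes almost everywhere in `Ω` outside the ball of
radius `|△|` about `v`. -/
theorem energy_hat_le (hd : 2 ≤ d) {β : ℝ} (hP : P.QuasiUniform β)
    (v : EuclideanSpace ℝ (Fin d)) :
    P.energy (P.hat v) ≤ (2 * β) ^ 2 *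
      volume.real (Metric.ball (0 : EuclideanSpace ℝ (Fin d)) 1) * P.meshSize ^ (d - 2) := by
  by_cases hv : ∃ T₀ ∈ P.simplices, v ∈ T₀
  swap
  · have h0 : P.energy (P.hat v) = P.energy fun _ => 0 := by
      refine energy_congr fun x hx => hat_eq_zero hx fun h => ?_
      obtain ⟨T, ⟨hT, q, hq, hqv⟩, -⟩ := mem_iUnion₂.1 h
      exact hv ⟨T, hT, by rwa [← Finset.mem_singleton.1 hqv]⟩
    have h1 : 0 ≤ P.meshSize := Real.sSup_nonneg (by
      rintro _ ⟨T, -, rfl⟩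
      exact Metric.diam_nonneg)
    rw [h0]
    simp only [energy, gradient_fun_const, norm_zero]
    simp only [ne_eq, OfNat.ofNat_ne_zero, not_false_eq_true, zero_pow, integral_zero]
    positivity
  obtain ⟨T₀, hT₀, -⟩ := hv
  have hh := meshSize_pos (by omega : 1 ≤ d) hT₀
  set b : ℝ := (2 * β * P.meshSize⁻¹) ^ 2 with hb
  have hle : P.energy (P.hat v) ≤ ∫ x in P.domain,
      (Metric.closedBall v P.meshSize).indicator (fun _ => b) x := by
    refine integral_mono_of_nonneg (.of_forall fun x => sq_nonneg _) ?_ ?_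
    · exact ((integrable_indicator_iff Metric.isClosed_closedBall.measurableSet).2
        (integrableOn_const (isCompact_closedBall _ _).measure_lt_top.ne)).restrict
    · filter_upwards [P.ae_mem_interior] with x ⟨T, hT, hx⟩
      have heq : P.hat v =ᶠ[nhds x] P.bary T v := by
        filter_upwards [isOpen_interior.mem_nhds hx] with y hy
          using hat_eq_bary hT (interior_subset hy) v
      rw [heq.gradient_eq]
      by_cases hvT : v ∈ T
      · have hxb : x ∈ Metric.closedBall v P.meshSize :=
          dist_le_meshSize hT (interior_subset hx) (subset_convexHull ℝ _ hvT)
        rw [indicator_of_mem hxb]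
        obtain ⟨hβ, c, ρ, hρ, hball, hmesh⟩ := hP.exists_ball (by omega) hT
        have h1 := norm_gradient_affine_le (P.bary T v) hρ (fun y hy =>
          ⟨(mem_hull_iff hT).1 (hball hy) v, bary_le_one hT (hball hy) v⟩) x
        have h2 : ρ⁻¹ ≤ 2 * β * P.meshSize⁻¹ := by
          rw [← one_div, div_le_iff₀ hρ, ← div_eq_mul_inv, div_mul_eq_mul_div, le_div_iff₀ hh,
            one_mul]
          exact hmesh
        exact pow_le_pow_left₀ (norm_nonneg _) (h1.trans h2) 2
      · rw [bary_of_notMem hvT]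
        change ‖gradient (fun _ => (0 : ℝ)) x‖ ^ 2 ≤ _
        rw [gradient_fun_const, norm_zero, zero_pow two_ne_zero]
        exact indicator_nonneg (fun _ _ => by positivity) x
  refine hle.trans ?_
  have h3 : ∫ x in P.domain, (Metric.closedBall v P.meshSize).indicator (fun _ => b) x ≤
      ∫ x, (Metric.closedBall v P.meshSize).indicator (fun _ => b) x := by
    refine setIntegral_le_integral ?_
      (.of_forall fun x => indicator_nonneg (fun _ _ => by positivity) x)
    exact (integrable_indicator_iff Metric.isClosed_closedBall.measurableSet).2
        (integrableOn_const (isCompact_closedBall _ _).measure_lt_top.ne)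
  refine h3.trans (le_of_eq ?_)
  rw [integral_indicator Metric.isClosed_closedBall.measurableSet, setIntegral_const, smul_eq_mul,
    Measure.real, Measure.addHaar_closedBall _ _ hh.le, finrank_euclideanSpace_fin,
    ENNReal.toReal_mul, ENNReal.toReal_ofReal (by positivity), ← Measure.real, hb]
  have h4 : P.meshSize ^ d = P.meshSize ^ 2 * P.meshSize ^ (d - 2) := by
    rw [← pow_add]; congr 1; omega
  rw [h4]
  field_simp

theorem hasLocalLift_zero (hd : 2 ≤ d) {n : ℕ} (hn : 1 ≤ n) {l : ℕ} (hl : 1 ≤ l) {β : ℝ}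
    (hP : P.QuasiUniform β) (p : EuclideanSpace ℝ (Fin d)) :
    P.HasLocalLift 0 n l ((2 * β) ^ 2 *
      volume.real (Metric.ball (0 : EuclideanSpace ℝ (Fin d)) 1)) p := by
  classical
  refine ⟨P.hat p, isSpline_hat hn p, fun s hs w hw0 hw1 _ => ?_,
    fun x hx hxs => hat_eq_zero hx fun h => hxs (starSet_mono hl h), energy_hat_le hd hP p⟩
  rw [hat_combination hs hw0 hw1]
  exact ⟨fun h => if_pos h, fun h => if_neg h⟩

theorem HasLocalLift.mono {r n l : ℕ} {A A' : ℝ} (h : A ≤ A') {p : EuclideanSpace ℝ (Fin d)}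
    (hA : P.HasLocalLift r n l A p) : P.HasLocalLift r n l A' p := by
  obtain ⟨G, h1, h2, h3, h4⟩ := hA
  have h5 : 0 ≤ P.meshSize := Real.sSup_nonneg (by
    rintro _ ⟨T, -, rfl⟩
    exact Metric.diam_nonneg)
  exact ⟨G, h1, h2, h3, h4.trans (mul_le_mul_of_nonneg_right h (by positivity))⟩

/-! ### Definiteness of the energy -/

theorem interior_hull_nonempty {T : Finset (EuclideanSpace ℝ (Fin d))} (hT : T ∈ P.simplices) :
    (interior (convexHull ℝ (T : Set (EuclideanSpace ℝ (Fin d))))).Nonempty := by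
  rw [interior_convexHull_nonempty_iff_affineSpan_eq_top]
  have := (simplexBasis hT).tot
  rwa [show range (simplexBasis hT) = (T : Set (EuclideanSpace ℝ (Fin d))) from
    Subtype.range_coe] at this

theorem IsSpline.eq_of_energy_eq_zero {r n : ℕ} {u : EuclideanSpace ℝ (Fin d) → ℝ}
    (hu : P.IsSpline r n u) (hE : P.energy u = 0) {T : Finset (EuclideanSpace ℝ (Fin d))}
    (hT : T ∈ P.simplices) {x y : EuclideanSpace ℝ (Fin d)}
    (hx : x ∈ convexHull ℝ (T : Set (EuclideanSpace ℝ (Fin d))))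
    (hy : y ∈ convexHull ℝ (T : Set (EuclideanSpace ℝ (Fin d)))) : u x = u y := by
  obtain ⟨p, -, hup, -⟩ := hu.exists_polyFun hT
  have hconv := convex_convexHull ℝ (T : Set (EuclideanSpace ℝ (Fin d)))
  have h1 := setIntegral_le_energy hu hT hup isOpen_interior interior_subset
  have h2 : ∫ x in interior (convexHull ℝ (T : Set (EuclideanSpace ℝ (Fin d)))),
      ‖gradient (polyFun p) x‖ ^ 2 = 0 :=
    le_antisymm (h1.trans hE.le) (integral_nonneg fun x => sq_nonneg _)
  obtain ⟨z, hz⟩ := interior_hull_nonempty hT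
  have h3 : ∀ x ∈ convexHull ℝ (T : Set (EuclideanSpace ℝ (Fin d))), polyFun p x = polyFun p z := by
    have hcl : convexHull ℝ (T : Set (EuclideanSpace ℝ (Fin d))) ⊆
        closure (interior (convexHull ℝ (T : Set (EuclideanSpace ℝ (Fin d))))) := by
      rw [hconv.closure_interior_eq_closure_of_nonempty_interior ⟨z, hz⟩]
      exact subset_closure
    intro x hx
    refine closure_minimal (fun y hy => ?_)
      (isClosed_eq (continuous_polyFun p) continuous_const) (hcl hx)
    exact eq_of_setIntegral_gradient_eq_zero (contDiff_polyFun p) isOpen_interior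
      hconv.interior ((isCompact_hull T).isBounded.subset interior_subset) h2 hy hz
  rw [hup x hx, hup y hy, h3 x hx, h3 y hy]

/-- Zero energy makes `u` constant on each simplex, so a level set is a neighbourhood of each of its
points interior to `Ω`. Being compact, it must contain a zero of `u`. -/
theorem IsSplineZero.eq_zero_of_energy_eq_zero {r n : ℕ} (hd : 1 ≤ d)
    {u : EuclideanSpace ℝ (Fin d) → ℝ} (hu : P.IsSplineZero r n u) (hE : P.energy u = 0)
    {x : EuclideanSpace ℝ (Fin d)} (hx : x ∈ P.domain) : u x = 0 := by
  by_contra hux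
  have hK : IsCompact (P.domain ∩ u ⁻¹' {u x}) :=
    P.isCompact_domain.of_isClosed_subset
      (hu.1.1.preimage_isClosed_of_isClosed P.isCompact_domain.isClosed isClosed_singleton)
      inter_subset_left
  obtain ⟨y, ⟨-, hy⟩, hy0⟩ := exists_eq_zero_of_mem_nhds hd hu hK ⟨x, hx, rfl⟩ inter_subset_left
    (by
      rintro y ⟨-, hyx⟩ hyi -
      filter_upwards [eventually_exists_hull (P := P) y, mem_interior_iff_mem_nhds.1 hyi]
        with z hz hzd
      obtain ⟨T, hT, hyT, hzT⟩ := hz hzd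
      exact ⟨hzd, (hu.1.eq_of_energy_eq_zero hE hT hzT hyT).trans hyx⟩)
  exact hux ((mem_singleton_iff.1 hy).symm.trans hy0)

/-! ### The boundary is a union of faces -/

/-- Translation by `y - x` carries a neighbourhood of `x` to one of `y`, and the simplices around
the two points are the same. A coordinate positive at `x` stays positive nearby; one that vanishes
at `x` also vanishes at `y`, so translation preserves its value. -/
theorem mem_interior_of_same_carrier {T : Finset (EuclideanSpace ℝ (Fin d))}
    (hT : T ∈ P.simplices) {x y : EuclideanSpace ℝ (Fin d)}
    (hx : x ∈ convexHull ℝ (T : Set (EuclideanSpace ℝ (Fin d))))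
    (hy : y ∈ convexHull ℝ (T : Set (EuclideanSpace ℝ (Fin d))))
    (hxy : ∀ v, P.bary T v x = 0 ↔ P.bary T v y = 0) (hyi : y ∈ interior P.domain) :
    x ∈ interior P.domain := by
  classical
  have h1 : ∀ᶠ z in nhds x, ∀ T' ∈ P.simplices, ∀ v ∈ T', 0 < P.bary T' v x →
      0 < P.bary T' v z := by
    rw [Filter.eventually_all_finite P.simplices_finite]
    intro T' _
    rw [Filter.eventually_all_finset]
    intro v _
    by_cases h : 0 < P.bary T' v x
    · obtain ⟨g, hg⟩ := exists_affine_eq_inner (P.bary T' v)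
      have hc : Continuous (P.bary T' v) := by
        rw [show (P.bary T' v : EuclideanSpace ℝ (Fin d) → ℝ) =
          fun x => inner ℝ g x + P.bary T' v 0 from funext hg]
        fun_prop
      filter_upwards [hc.continuousAt.eventually (lt_mem_nhds h)] with z hz _ using hz
    · exact .of_forall fun z h' => (h h').elim
  have h2 : ∀ᶠ z in nhds x, ∃ T' ∈ P.simplices,
      y ∈ convexHull ℝ (T' : Set (EuclideanSpace ℝ (Fin d))) ∧
      y + (z - x) ∈ convexHull ℝ (T' : Set (EuclideanSpace ℝ (Fin d))) := by
    have hc : Filter.Tendsto (fun z => y + (z - x)) (nhds x) (nhds y) := by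
      have : Continuous fun z => y + (z - x) := by fun_prop
      simpa using this.tendsto x
    filter_upwards [hc.eventually (eventually_exists_hull (P := P) y),
      hc.eventually (mem_interior_iff_mem_nhds.1 hyi)] with z hz hzd using hz hzd
  rw [mem_interior_iff_mem_nhds]
  filter_upwards [h1, h2] with z hz1 ⟨T', hT', hyT', hzT'⟩
  have hxT' : x ∈ convexHull ℝ (T' : Set (EuclideanSpace ℝ (Fin d))) := by
    have hsub : ({v ∈ T | P.bary T v x ≠ 0} : Finset _) ⊆ T' := by
      intro v hv
      have h3 := (Finset.mem_filter.1 hv).2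
      by_contra hvT'
      refine h3 ((hxy v).2 ?_)
      rw [bary_eq_bary hT hT' hy hyT', bary_of_notMem hvT']
      rfl
    refine convexHull_mono (Finset.coe_subset.2 hsub) (Finset.mem_convexHull'.2
      ⟨fun v => P.bary T v x, fun v _ => (mem_hull_iff hT).1 hx v, ?_, ?_⟩)
    · rw [Finset.sum_filter_ne_zero, sum_bary hT]
    · rw [Finset.sum_filter_of_ne, sum_bary_smul hT]
      intro v _ hv h0
      exact hv (by simp [h0])
  refine mem_domain_iff.2 ⟨T', hT', (mem_hull_iff hT').2 fun v => ?_⟩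
  rcases ((mem_hull_iff hT').1 hxT' v).lt_or_eq with h3 | h3
  · by_cases hv : v ∈ T'
    · exact (hz1 T' hT' v hv h3).le
    · rw [bary_of_notMem hv]
      exact le_rfl
  · have h4 : P.bary T' v y = 0 := by
      rw [← bary_eq_bary hT hT' hy hyT', ← hxy, bary_eq_bary hT hT' hx hxT', ← h3]
    have h5 := (mem_hull_iff hT').1 hzT' v
    obtain ⟨g, hg⟩ := exists_affine_eq_inner (P.bary T' v)
    rw [hg] at h3 h4 h5 ⊢
    rw [inner_add_right, inner_sub_right] at h5
    linarith

/-- If `y` were interior, so would be a point slightly towards `x`; that point already has the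
carrier of `x`. -/
theorem mem_frontier_of_carrier_subset {T : Finset (EuclideanSpace ℝ (Fin d))}
    (hT : T ∈ P.simplices) {x y : EuclideanSpace ℝ (Fin d)}
    (hx : x ∈ convexHull ℝ (T : Set (EuclideanSpace ℝ (Fin d))))
    (hy : y ∈ convexHull ℝ (T : Set (EuclideanSpace ℝ (Fin d))))
    (hxy : ∀ v, P.bary T v x = 0 → P.bary T v y = 0) (hxf : x ∈ frontier P.domain) :
    y ∈ frontier P.domain := by
  refine ⟨subset_closure (hull_subset_domain hT hy), fun hyi => hxf.2 ?_⟩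
  have hc : Filter.Tendsto (fun t : ℝ => AffineMap.lineMap y x t) (nhdsWithin 0 (Ioo 0 1))
      (nhds y) := by
    have : Continuous fun t : ℝ => (AffineMap.lineMap y x t : EuclideanSpace ℝ (Fin d)) :=
      AffineMap.lineMap_continuous
    simpa using (this.tendsto 0).mono_left nhdsWithin_le_nhds
  have hne : (nhdsWithin (0 : ℝ) (Ioo 0 1)).NeBot := by
    rw [nhdsWithin_Ioo_eq_nhdsGT zero_lt_one]
    infer_instance
  obtain ⟨t, hti, ht0, ht1⟩ := ((hc.eventually (isOpen_interior.mem_nhds hyi)).and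
    self_mem_nhdsWithin).exists
  refine mem_interior_of_same_carrier hT hx ?_ (fun v => ?_) hti
  · exact (convex_convexHull ℝ _).lineMap_mem hy hx ⟨ht0.le, ht1.le⟩
  · rw [AffineMap.apply_lineMap, AffineMap.lineMap_apply_module]
    have h1 := (mem_hull_iff hT).1 hx v
    have h2 := (mem_hull_iff hT).1 hy v
    simp only [smul_eq_mul]
    constructor
    · intro h
      rw [h, hxy v h]
      simp
    · intro h
      nlinarith [mul_nonneg (sub_nonneg.2 ht1.le) h2, mul_nonneg ht0.le h1]

/-! ### Restriction of a spline to the faces spanned by a set of vertices -/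

variable (P) in
/-- In terms of the homogeneous Bernstein representation, `faceRestrict n A u` keeps the
Bernstein polynomials of `u` that contain vertices of `A` only. -/
def faceRestrict (n : ℕ) (A : Finset (EuclideanSpace ℝ (Fin d)))
    (u : EuclideanSpace ℝ (Fin d) → ℝ) (x : EuclideanSpace ℝ (Fin d)) : ℝ :=
  (∑ v ∈ A, P.hat v x) ^ n * u ((∑ v ∈ A, P.hat v x)⁻¹ • ∑ v ∈ A, P.hat v x • v)

theorem sum_hat_smul {M : Type*} [AddCommGroup M] [Module ℝ M]
    [DecidableEq (EuclideanSpace ℝ (Fin d))] {T : Finset (EuclideanSpace ℝ (Fin d))}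
    (hT : T ∈ P.simplices) {x : EuclideanSpace ℝ (Fin d)}
    (hx : x ∈ convexHull ℝ (T : Set (EuclideanSpace ℝ (Fin d))))
    (A : Finset (EuclideanSpace ℝ (Fin d))) (f : EuclideanSpace ℝ (Fin d) → M) :
    ∑ v ∈ A, P.hat v x • f v = ∑ v ∈ A ∩ T, P.bary T v x • f v := by
  simp only [hat_eq_bary hT hx]
  refine (Finset.sum_subset Finset.inter_subset_left fun v hvA hv => ?_).symm
  rw [bary_of_notMem fun h => hv (Finset.mem_inter.2 ⟨hvA, h⟩)]
  exact zero_smul _ _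

theorem sum_hat [DecidableEq (EuclideanSpace ℝ (Fin d))]
    {T : Finset (EuclideanSpace ℝ (Fin d))}
    (hT : T ∈ P.simplices) {x : EuclideanSpace ℝ (Fin d)}
    (hx : x ∈ convexHull ℝ (T : Set (EuclideanSpace ℝ (Fin d))))
    (A : Finset (EuclideanSpace ℝ (Fin d))) :
    ∑ v ∈ A, P.hat v x = ∑ v ∈ A ∩ T, P.bary T v x := by
  simpa using sum_hat_smul hT hx A fun _ => (1 : ℝ)

open Classical in
theorem faceRestrict_point {T : Finset (EuclideanSpace ℝ (Fin d))}
    (hT : T ∈ P.simplices) {x : EuclideanSpace ℝ (Fin d)}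
    (hx : x ∈ convexHull ℝ (T : Set (EuclideanSpace ℝ (Fin d))))
    {A : Finset (EuclideanSpace ℝ (Fin d))} (h : ∑ v ∈ A, P.hat v x ≠ 0) :
    (∑ v ∈ A, P.hat v x)⁻¹ • ∑ v ∈ A, P.hat v x • v ∈
      convexHull ℝ (T : Set (EuclideanSpace ℝ (Fin d))) ∧
    ∀ v, P.bary T v x = 0 →
      P.bary T v ((∑ v ∈ A, P.hat v x)⁻¹ • ∑ v ∈ A, P.hat v x • v) = 0 := by
  rw [sum_hat hT hx] at h ⊢
  rw [sum_hat_smul hT hx A fun v => v, Finset.smul_sum]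
  set σ := ∑ v ∈ A ∩ T, P.bary T v x
  simp only [smul_smul]
  have hw1 : ∑ v ∈ A ∩ T, σ⁻¹ * P.bary T v x = 1 := by
    rw [← Finset.mul_sum]
    exact inv_mul_cancel₀ h
  have hx0 := (mem_hull_iff hT).1 hx
  have hσ : 0 ≤ σ := Finset.sum_nonneg fun v _ => hx0 v
  constructor
  · refine convexHull_mono (Finset.coe_subset.2 Finset.inter_subset_right)
      (Finset.mem_convexHull'.2 ⟨fun v => σ⁻¹ * P.bary T v x, fun v _ => ?_, hw1, rfl⟩)
    exact mul_nonneg (inv_nonneg.2 hσ) (hx0 v)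
  · intro v hv
    rw [bary_combination hT Finset.inter_subset_right hw1]
    split_ifs
    · rw [hv, mul_zero]
    · rfl

/-- Homogenization clears the denominator: on `T` a monomial `x ^ γ` of `u` becomes `m ^ γ * s ^ (n
- |γ|)` with `m` and `s` affine, hence of degree at most `n`. -/
theorem isSpline_faceRestrict {n : ℕ} (hn : 1 ≤ n) (A : Finset (EuclideanSpace ℝ (Fin d)))
    {u : EuclideanSpace ℝ (Fin d) → ℝ} (hu : P.IsSpline 0 n u) :
    P.IsSpline 0 n (P.faceRestrict n A u) := by
  classical
  rw [isSpline_zero_iff] at hu ⊢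
  intro T hT
  obtain ⟨p, hp, hup⟩ := hu T hT
  choose b hb hbf using fun v => exists_polyFun_eq_affine (P.bary T v)
  set s : MvPolynomial (Fin d) ℝ := ∑ v ∈ A ∩ T, b v with hs
  set m : Fin d → MvPolynomial (Fin d) ℝ := fun i => ∑ v ∈ A ∩ T, v i • b v with hm
  have hsdeg : s.totalDegree ≤ 1 := MvPolynomial.totalDegree_finsetSum_le fun v _ => hb v
  have hmdeg : ∀ i, (m i).totalDegree ≤ 1 := fun i =>
    MvPolynomial.totalDegree_finsetSum_le fun v _ =>
      (MvPolynomial.totalDegree_smul_le _ _).trans (hb v)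
  refine ⟨∑ γ ∈ p.support, p.coeff γ • ((∏ i, m i ^ γ i) * s ^ (n - γ.sum fun _ e => e)), ?_,
    fun x hx => ?_⟩
  · refine MvPolynomial.totalDegree_finsetSum_le fun γ hγ => ?_
    refine (MvPolynomial.totalDegree_smul_le _ _).trans ?_
    refine (MvPolynomial.totalDegree_mul _ _).trans ?_
    have h1 : (∏ i, m i ^ γ i).totalDegree ≤ γ.sum fun _ e => e := by
      refine (MvPolynomial.totalDegree_finsetProd _ _).trans ?_
      rw [Finsupp.sum_fintype _ _ fun _ => rfl]
      exact Finset.sum_le_sum fun i _ => (MvPolynomial.totalDegree_pow _ _).trans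
        (by nlinarith [hmdeg i])
    have h2 : (s ^ (n - γ.sum fun _ e => e)).totalDegree ≤ n - γ.sum fun _ e => e :=
      (MvPolynomial.totalDegree_pow _ _).trans (by nlinarith)
    have h3 := (MvPolynomial.le_totalDegree hγ).trans hp
    omega
  · have hsx : polyFun s x = ∑ v ∈ A, P.hat v x := by
      rw [sum_hat hT hx, hs, polyFun, map_sum]
      exact Finset.sum_congr rfl fun v _ => (hbf v x).symm
    have hmx : ∀ i, polyFun (m i) x = (∑ v ∈ A, P.hat v x • v) i := by
      intro i
      rw [sum_hat_smul hT hx A fun v => v, hm]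
      simp only [polyFun_sum_smul, ← hbf, WithLp.ofLp_sum, Finset.sum_apply, PiLp.smul_apply,
        smul_eq_mul]
      exact Finset.sum_congr rfl fun v _ => mul_comm _ _
    have hq : polyFun (∑ γ ∈ p.support, p.coeff γ • ((∏ i, m i ^ γ i) *
        s ^ (n - γ.sum fun _ e => e))) x = ∑ γ ∈ p.support, p.coeff γ *
          ((∏ i, polyFun (m i) x ^ γ i) * polyFun s x ^ (n - γ.sum fun _ e => e)) := by
      rw [polyFun_sum_smul]
      simp [polyFun]
    rw [hq, hsx]
    simp only [hmx]
    set σ := ∑ v ∈ A, P.hat v x with hσ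
    set M := ∑ v ∈ A, P.hat v x • v with hM
    have hfr : P.faceRestrict n A u x = σ ^ n * u (σ⁻¹ • M) := rfl
    rw [hfr]
    -- Where all hats of `A` vanish, `M = 0` too. Every term then has a zero factor: a power of `s`
    -- if `|γ| < n`, and some `m i` if `|γ| = n ≥ 1`.
    by_cases h0 : σ = 0
    · have hM0 : M = 0 := by
        rw [hM]
        refine Finset.sum_eq_zero fun v hv => ?_
        have hnn : ∀ v ∈ A, 0 ≤ P.hat v x := fun v _ => by
          rw [hat_eq_bary hT hx]; exact (mem_hull_iff hT).1 hx v
        rw [(Finset.sum_eq_zero_iff_of_nonneg hnn).1 h0 v hv, zero_smul]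
      rw [h0, hM0, zero_pow (by omega), zero_mul, eq_comm]
      refine Finset.sum_eq_zero fun γ hγ => ?_
      by_cases hγn : n - (γ.sum fun _ e => e) = 0
      · have : γ ≠ 0 := by
          rintro rfl
          simp at hγn
          omega
        obtain ⟨i, hi⟩ := Finsupp.ne_iff.1 this
        rw [Finset.prod_eq_zero (Finset.mem_univ i), zero_mul, mul_zero]
        exact zero_pow hi
      · rw [zero_pow hγn, mul_zero, mul_zero]
    · rw [hup _ (faceRestrict_point hT hx h0).1, polyFun, MvPolynomial.eval_eq', Finset.mul_sum]
      refine Finset.sum_congr rfl fun γ hγ => ?_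
      have h3 := (MvPolynomial.le_totalDegree hγ).trans hp
      have h4 : σ ^ n = (∏ i, σ ^ γ i) * σ ^ (n - γ.sum fun _ e => e) := by
        rw [Finset.prod_pow_eq_pow_sum, ← Finsupp.sum_fintype γ (fun _ e => e) fun _ => rfl,
          ← pow_add]
        congr 1
        omega
      have h5 : (∏ i, σ ^ γ i) * ∏ i, (σ⁻¹ • M) i ^ γ i = ∏ i, M i ^ γ i := by
        rw [← Finset.prod_mul_distrib]
        refine Finset.prod_congr rfl fun i _ => ?_
        rw [← mul_pow, PiLp.smul_apply, smul_eq_mul, mul_inv_cancel_left₀ h0]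
      rw [h4, ← h5]
      ring

/-- The point at which `u` is evaluated uses only vertices from the carrier of `x`, so it stays on
the boundary with `x`. -/
theorem IsSplineZero.faceRestrict {n : ℕ} (hn : 1 ≤ n) (A : Finset (EuclideanSpace ℝ (Fin d)))
    {u : EuclideanSpace ℝ (Fin d) → ℝ} (hu : P.IsSplineZero 0 n u) :
    P.IsSplineZero 0 n (P.faceRestrict n A u) := by
  refine ⟨isSpline_faceRestrict hn A hu.1, fun x hx => ?_⟩
  obtain ⟨T, hT, hxT⟩ := mem_domain_iff.1 (P.isCompact_domain.isClosed.frontier_subset hx)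
  rw [SimplicialPartition.faceRestrict]
  by_cases h0 : ∑ v ∈ A, P.hat v x = 0
  · rw [h0, zero_pow (by omega), zero_mul]
  · obtain ⟨h1, h2⟩ := faceRestrict_point hT hxT h0
    rw [hu.2 _ (mem_frontier_of_carrier_subset hT hxT h1 h2 hx), mul_zero]

theorem faceRestrict_of_notMem {n : ℕ} (hn : 1 ≤ n) (A : Finset (EuclideanSpace ℝ (Fin d)))
    (u : EuclideanSpace ℝ (Fin d) → ℝ) {x : EuclideanSpace ℝ (Fin d)} (hx : x ∉ P.domain) :
    P.faceRestrict n A u x = 0 := by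
  have : ∀ v, P.hat v x = 0 := fun v => dif_neg fun h => hx (mem_domain_iff.2 h)
  simp only [faceRestrict, this, Finset.sum_const_zero]
  rw [zero_pow (by omega), zero_mul]

theorem faceRestrict_insert [DecidableEq (EuclideanSpace ℝ (Fin d))] {n : ℕ}
    {A : Finset (EuclideanSpace ℝ (Fin d))} {v : EuclideanSpace ℝ (Fin d)} (hv : v ∉ A)
    (u : EuclideanSpace ℝ (Fin d) → ℝ) {x : EuclideanSpace ℝ (Fin d)} (hx : P.hat v x = 0) :
    P.faceRestrict n (insert v A) u x = P.faceRestrict n A u x := by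
  simp only [faceRestrict, Finset.sum_insert hv, hx, zero_add, zero_smul]

theorem faceRestrict_eq_self {n : ℕ} {A : Finset (EuclideanSpace ℝ (Fin d))}
    (hA : ∀ T ∈ P.simplices, T ⊆ A) (u : EuclideanSpace ℝ (Fin d) → ℝ)
    {x : EuclideanSpace ℝ (Fin d)} (hx : x ∈ P.domain) : P.faceRestrict n A u x = u x := by
  classical
  obtain ⟨T, hT, hxT⟩ := mem_domain_iff.1 hx
  rw [faceRestrict, sum_hat hT hxT, sum_hat_smul hT hxT A fun v => v,
    Finset.inter_eq_right.2 (hA T hT), sum_bary hT, sum_bary_smul hT]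
  simp

/-! ### A local Riesz basis for continuous splines -/

variable (P) in
/-- The splines that vanish on the boundary, normalized to be zero off the domain. -/
def zeroSplineSpace (r n : ℕ) : Submodule ℝ (P.splineSpace r n) where
  carrier := {u | (∀ x ∈ frontier P.domain, u.1 x = 0) ∧ ∀ x ∉ P.domain, u.1 x = 0}
  zero_mem' := ⟨fun _ _ => rfl, fun _ _ => rfl⟩
  add_mem' := fun {u v} hu hv =>
    ⟨fun x hx => by simp [hu.1 x hx, hv.1 x hx], fun x hx => by simp [hu.2 x hx, hv.2 x hx]⟩
  smul_mem' := fun c u hu => ⟨fun x hx => by simp [hu.1 x hx], fun x hx => by simp [hu.2 x hx]⟩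

-- Choosing one simplex for each point of `Ω` assembles a family of polynomials into a function.
-- This linear map has finite-dimensional range, which contains every normalized zero spline.
open Classical in
instance finiteDimensional_zeroSplineSpace (r n : ℕ) :
    FiniteDimensional ℝ (P.zeroSplineSpace r n) := by
  have := P.simplices_finite.to_subtype
  let Φ : (P.simplices → MvPolynomial.restrictTotalDegree (Fin d) ℝ n) →ₗ[ℝ]
      (EuclideanSpace ℝ (Fin d) → ℝ) :=
    { toFun := fun p x => if h : ∃ T : P.simplices,
          x ∈ convexHull ℝ (T : Set (EuclideanSpace ℝ (Fin d)))
        then polyFun (p h.choose).1 x else 0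
      map_add' := fun p q => by
        ext x
        by_cases h : ∃ T : P.simplices, x ∈ convexHull ℝ (T : Set (EuclideanSpace ℝ (Fin d)))
        · simp only [dif_pos h, Pi.add_apply, Submodule.coe_add, polyFun_add]
        · simp only [dif_neg h, Pi.add_apply, add_zero]
      map_smul' := fun c p => by
        ext x
        by_cases h : ∃ T : P.simplices, x ∈ convexHull ℝ (T : Set (EuclideanSpace ℝ (Fin d)))
        · simp only [dif_pos h, Pi.smul_apply, Submodule.coe_smul, polyFun_smul, RingHom.id_apply]
        · simp only [dif_neg h, Pi.smul_apply, smul_zero, RingHom.id_apply] }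
  let ι : P.zeroSplineSpace r n →ₗ[ℝ] LinearMap.range Φ :=
    LinearMap.codRestrict _ ((P.splineSpace r n).subtype.comp (P.zeroSplineSpace r n).subtype) (by
      intro u
      choose p hp hup using fun T : P.simplices => u.1.2.2.2 T.1 T.2
      refine ⟨fun T => ⟨p T, (MvPolynomial.mem_restrictTotalDegree _ _ _).2 (hp T)⟩, ?_⟩
      ext x
      by_cases h : ∃ T : P.simplices, x ∈ convexHull ℝ (T : Set (EuclideanSpace ℝ (Fin d)))
      · simp only [Φ, LinearMap.coe_mk, AddHom.coe_mk, dif_pos h]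
        exact (hup _ x h.choose_spec).symm
      · simp only [Φ, LinearMap.coe_mk, AddHom.coe_mk, dif_neg h]
        refine (u.2.2 x fun hx => h ?_).symm
        obtain ⟨T, hT, hxT⟩ := mem_domain_iff.1 hx
        exact ⟨⟨T, hT⟩, hxT⟩)
  refine FiniteDimensional.of_injective ι fun u v huv => ?_
  exact Subtype.ext (Subtype.ext (congrArg (fun w : LinearMap.range Φ => w.1) huv))

variable (P) in
/-- The elements of the zero spline space that are supported in the star of a simplex. -/
def localSplines (r n l : ℕ) : Set (P.zeroSplineSpace r n) :=
  {u | ∃ T ∈ P.simplices, ∀ x ∈ P.domain, x ∉ P.starSet T l → u.1.1 x = 0}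

/-- Telescoping over vertices: with all vertices `faceRestrict` is the identity, with none it is
zero, and inserting `v` changes the spline only in the star of `v`, hence in that of any simplex
containing `v`. -/
theorem span_localSplines {n : ℕ} (hn : 1 ≤ n) :
    Submodule.span ℝ (P.localSplines 0 n 1) = ⊤ := by
  classical
  rw [eq_top_iff]
  rintro u -
  have hu : P.IsSplineZero 0 n u.1.1 := ⟨u.1.2, u.2.1⟩
  let R : Finset (EuclideanSpace ℝ (Fin d)) → P.zeroSplineSpace 0 n := fun A =>
    ⟨⟨P.faceRestrict n A u.1.1, (hu.faceRestrict hn A).1⟩, (hu.faceRestrict hn A).2,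
      fun x hx => faceRestrict_of_notMem hn A _ hx⟩
  set V : Finset (EuclideanSpace ℝ (Fin d)) := P.simplices_finite.toFinset.biUnion id with hV
  have hRV : R V = u := by
    refine Subtype.ext (Subtype.ext (funext fun x => ?_))
    by_cases hx : x ∈ P.domain
    · refine faceRestrict_eq_self (fun T hT v hv => ?_) _ hx
      exact Finset.mem_biUnion.2 ⟨T, P.simplices_finite.mem_toFinset.2 hT, hv⟩
    · rw [u.2.2 x hx]
      exact faceRestrict_of_notMem hn V _ hx
  have hR : ∀ A ⊆ V, R A ∈ Submodule.span ℝ (P.localSplines 0 n 1) := by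
    intro A
    induction A using Finset.induction_on with
    | empty =>
      intro _
      have : R ∅ = 0 := by
        refine Subtype.ext (Subtype.ext (funext fun x => ?_))
        simp only [R, faceRestrict, Finset.sum_empty]
        rw [zero_pow (by omega), zero_mul]
        rfl
      rw [this]
      exact Submodule.zero_mem _
    | insert v A hv ih =>
      intro hA
      rw [← sub_add_cancel (R (insert v A)) (R A)]
      refine Submodule.add_mem _ (Submodule.subset_span ?_)
        (ih ((Finset.subset_insert _ _).trans hA))
      obtain ⟨T, hT, hvT⟩ := Finset.mem_biUnion.1 (hA (Finset.mem_insert_self v A))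
      refine ⟨T, P.simplices_finite.mem_toFinset.1 hT, fun x hx hxT => ?_⟩
      refine sub_eq_zero.2 (faceRestrict_insert hv _ (hat_eq_zero hx fun h => hxT ?_))
      obtain ⟨T', ⟨hT', q, hq, hqv⟩, hxT'⟩ := mem_iUnion₂.1 h
      rw [Finset.mem_singleton] at hqv
      exact mem_biUnion (mem_star_one hT' hq (hqv ▸ hvT)) hxT'
  rw [← hRV]
  exact hR V subset_rfl

theorem exists_basis_of_span_eq_top {V : Type*} [AddCommGroup V] [Module ℝ V]
    [FiniteDimensional ℝ V] {s : Set V} (hs : Submodule.span ℝ s = ⊤) :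
    ∃ (m : ℕ) (B : Fin m → V), LinearIndependent ℝ B ∧ Submodule.span ℝ (range B) = ⊤ ∧
      ∀ i, B i ∈ s := by
  obtain ⟨b, hbs, hbspan, hbli⟩ := exists_linearIndependent ℝ s
  have hfin : Finite b := hbli.setFinite
  obtain ⟨m, ⟨e⟩⟩ := Finite.exists_equiv_fin b
  refine ⟨m, Subtype.val ∘ e.symm, hbli.comp e.symm e.symm.injective, ?_,
    fun i => hbs (e.symm i).2⟩
  rw [e.symm.surjective.range_comp, Subtype.range_coe, hbspan, hs]

theorem hasLocalRieszBasis_zero (hd : 1 ≤ d) {n : ℕ} (hn : 1 ≤ n) (P : SimplicialPartition d) :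
    ∃ κ : ℝ, P.HasLocalRieszBasis 0 n 1 κ := by
  obtain ⟨m, B, hBli, hBspan, hBloc⟩ :=
    exists_basis_of_span_eq_top (V := P.zeroSplineSpace 0 n) (s := P.localSplines 0 n 1)
      (span_localSplines hn)
  have hcoe : ∀ c : Fin m → ℝ, (∑ ξ, c ξ • (B ξ).1 : P.splineSpace 0 n) =
      (∑ ξ, c ξ • B ξ : P.zeroSplineSpace 0 n).1 := by
    intro c; simp
  have hcoe' : ∀ c : Fin m → ℝ, ((∑ ξ, c ξ • (B ξ).1 : P.splineSpace 0 n) :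
      EuclideanSpace ℝ (Fin d) → ℝ) = fun x => ∑ ξ, c ξ * (B ξ).1.1 x := by
    intro c
    ext x
    simp [Finset.sum_apply]
  obtain ⟨C₁, hC₁, C₂, hC⟩ := exists_coercive (P.dirichlet 0 n) (fun ξ => (B ξ).1) (by
    intro c hc
    refine (dirichlet_self_nonneg _).lt_of_ne fun h0 => hc ?_
    rw [dirichlet_self, hcoe] at h0
    have h1 : ∑ ξ, c ξ • B ξ = 0 := by
      set w := ∑ ξ, c ξ • B ξ
      refine Subtype.ext (Subtype.ext (funext fun x => ?_))
      by_cases hx : x ∈ P.domain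
      · exact IsSplineZero.eq_zero_of_energy_eq_zero hd ⟨w.1.2, w.2.1⟩ h0.symm hx
      · exact w.2.2 x hx
    exact funext (Fintype.linearIndependent_iff.1 hBli c h1))
  choose τ hτ using show ∀ i, ∃ T, T ∈ P.simplices ∧
    ∀ x ∈ P.domain, x ∉ P.starSet T 1 → (B i).1.1 x = 0 from hBloc
  refine ⟨C₂ / C₁, m, fun ξ => (B ξ).1.1, τ, C₁, C₂, hC₁, (div_mul_cancel₀ _ hC₁.ne').ge,
    fun ξ => ⟨(B ξ).1.2, (B ξ).2.1⟩, hτ, fun u hu => ?_, fun c => ?_⟩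
  -- Values off `Ω` are unconstrained for a spline, so `u` is cut off to fit the normalized space.
  · let w : P.zeroSplineSpace 0 n := ⟨⟨P.domain.indicator u, by
      rw [mem_splineSpace, isSpline_zero_iff]
      intro T hT
      obtain ⟨p, hp, hup, -⟩ := hu.1.exists_polyFun hT
      exact ⟨p, hp, fun x hx => by rw [indicator_of_mem (hull_subset_domain hT hx), hup x hx]⟩⟩,
      fun x hx => (indicator_of_mem (P.isCompact_domain.isClosed.frontier_subset hx) u).trans
        (hu.2 x hx),
      fun x hx => indicator_of_notMem hx _⟩
    have hw : w ∈ Submodule.span ℝ (range B) := by rw [hBspan]; trivial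
    obtain ⟨c, hc⟩ := (Submodule.mem_span_range_iff_exists_fun ℝ).1 hw
    refine ⟨c, fun x hx => ?_⟩
    have h1 := congrFun (hcoe' c) x
    rw [hcoe, hc] at h1
    rw [← h1]
    exact (indicator_of_mem hx u).symm
  · have h1 := hC c
    rwa [dirichlet_self, hcoe' c] at h1

end SimplicialPartition

end GBC

end

/-! ### Assembly of the two assertions -/

theorem mainTheorem2 :
    (∀ (κ : ℝ) (l : ℕ), 1 ≤ l → ∃ σ : ℝ, 0 < σ ∧ σ < 1 ∧
      ∀ (d n : ℕ) (β A : ℝ), 2 ≤ d → 1 ≤ n → ∃ K : ℝ, 0 < K ∧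
        ∀ (r : ℕ) (P : GBC.SimplicialPartition d), P.QuasiUniform β →
          P.HasLocalRieszBasis r n l κ →
          ∀ p ∈ P.complex.vertices, p ∈ frontier P.domain →
            (r = 0 ∨ P.HasLocalLift r n l A p) →
            ∀ S : EuclideanSpace ℝ (Fin d) → ℝ, P.IsBoundaryGBCSpline r n p S →
              ∀ v ∈ P.domain, v ∉ P.starSet {p} 1 →
              ∀ T ∈ P.simplices, v ∈ convexHull ℝ (T : Set (EuclideanSpace ℝ (Fin d))) →
              ∀ k : ℕ, 1 ≤ k → Disjoint (P.starSet T k) (P.starSet {p} 1) →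
              ∀ L : ℕ, 1 ≤ L → P.IsSimplicesAwayOpposite p k T L →
                |S v| ≤ K * (L + 1) * σ ^ k) ∧
    (∀ (d n : ℕ), 2 ≤ d → 1 ≤ n → ∀ P : GBC.SimplicialPartition d,
      ∃ κ : ℝ, P.HasLocalRieszBasis 0 n 1 κ) := by
  refine ⟨fun κ l hl => ?_, fun d n hd hn P =>
    GBC.SimplicialPartition.hasLocalRieszBasis_zero (by omega) hn P⟩
  obtain ⟨σ, hσ0, hσ1, h⟩ := GBC.SimplicialPartition.exists_decay_of_lift κ l
  refine ⟨σ, hσ0, hσ1, fun d n β A hd hn => ?_⟩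
  set A₀ := (2 * β) ^ 2 *
    volume.real (Metric.ball (0 : EuclideanSpace ℝ (Fin d)) 1) with hA₀
  -- `A₀` is the energy constant of the hat function and depends on `d` and `β` only; the maximum
  -- serves both the given lift and the case `r = 0`.
  obtain ⟨K, hK, hKb⟩ := h d n β (max A A₀) hd
  refine ⟨K, hK, fun r P hP hbasis p hp hpf hlift S hS v _ _ T hT hvT k hk hdisj L _ _ => ?_⟩
  have hlift' : P.HasLocalLift r n l (max A A₀) p := by
    rcases hlift with rfl | hlift
    · exact (GBC.SimplicialPartition.hasLocalLift_zero hd hn hl hP p).mono (le_max_right _ _)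
    · exact hlift.mono (le_max_left _ _)
  refine (hKb r P hP hbasis p hp hpf hlift' S hS v T hT hvT k hk hdisj).trans ?_
  refine mul_le_mul_of_nonneg_right (le_mul_of_one_le_right hK.le ?_) (by positivity)
  linarith [(Nat.cast_nonneg L : (0 : ℝ) ≤ L)]
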